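/- **Theorem (Testing in 2-SBMs).** For each $n$ let $p=p(n)=(p_1,p_2)$ be a probability vector and let $Q=Q(n)$ be a symmetric $2\times2$ real matrix with entries in $[-1,1]$. In $\mathbb{SBM}(n;p,Q)$ the vertices $1,\dots,n$ receive i.i.d. labels $x_1,\dots,x_n\sim p$ and, given the labels, each pair $i<j$ is independently an edge with probability $\frac{1+Q_{x_i,x_j}}{2}$. A sequence of real-valued graph statistics $f_n$ is said to distinguish $\mathbb{SBM}(n;p,Q)$ from $\mathbb G(n,1/2)$ with high probability if $$\Big|\mathbb E_{\mathbb{SBM}(n;p,Q)}f_n-\mathbb E_{\mathbb G(n,1/2)}f_n\Big|=\omega\Big(\max\big(\operatorname{Var}_{\mathbb{SBM}(n;p,Q)}f_n,\operatorname{Var}_{\mathbb G(n,1/2)}f_n\big)^{1/2}\Big)\qquad(n\to\infty),$$ where $a_n=\omega(b_n)$ means that for every constant $C$ one has $a_n>C\,b_n$ for all sufficiently large $n$. The signed count of a graph $H$ without isolated vertices is $\mathsf{SC}_H(G)=\sum_{K}\prod_{e\in E(K)}(2\cdot\mathbf 1[e\in E(G)]-1)$, where $K$ ranges over the copies of $H$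 in the complete graph on $\{1,\dots,n\}$. Let $D\ge4$ be an even integer not depending on $n$, and assume $\min(p_1,p_2)=\omega(1/n)$. Suppose that there are polynomials $f_n$ of degree at most $D$ in the edge indicators which distinguish $\mathbb{SBM}(n;p,Q)$ from $\mathbb G(n,1/2)$ with high probability. Then there are graphs $H_n$, each of them the 4-cycle or a star with $t$ edges for some $1\le t\le D$ ($H_n$ may depend on $n$, as $p$ and $Q$ do), such that $\mathsf{SC}_{H_n}$ distinguishes $\mathbb{SBM}(n;p,Q)$ from $\mathbb G(n,1/2)$ with high probability. -/

import Mathlib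

/-- Parameters of a stochastic block model on `k` communities: a probability vector `p` and a
symmetric matrix `Q` with entries in `[-1, 1]`. -/
structure SBM (k : ℕ) where
  p : Fin k → ℝ
  Q : Matrix (Fin k) (Fin k) ℝ
  p_nonneg : ∀ a, 0 ≤ p a
  p_sum : ∑ a, p a = 1
  Q_symm : Q.IsSymm
  Q_abs_le : ∀ a b, |Q a b| ≤ 1

open Classical in
/-- Probability mass function of the block model on graphs with vertex set `Fin n`: the labels
`x i` are i.i.d. with law `p` and, given the labels, each pair `i < j` is independently an edge with
probability `(1 + Q (x i) (x j)) / 2`. -/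
noncomputable def SBM.law {k : ℕ} (M : SBM k) (n : ℕ) (G : SimpleGraph (Fin n)) : ℝ :=
  ∑ x : Fin n → Fin k, (∏ i, M.p (x i)) *
    ∏ i, ∏ j ∈ Finset.Ioi i,
      if G.Adj i j then (1 + M.Q (x i) (x j)) / 2 else 1 - (1 + M.Q (x i) (x j)) / 2

open Classical in
/-- Probability mass function of the Erdős–Rényi random graph with edge probability `q`. -/
noncomputable def erdosRenyiLaw (q : ℝ) (n : ℕ) (G : SimpleGraph (Fin n)) : ℝ :=
  ∏ i, ∏ j ∈ Finset.Ioi i, if G.Adj i j then q else 1 - q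

/-- Expectation of a graph statistic under a probability mass function on graphs. -/
noncomputable def graphMean {n : ℕ} (μ f : SimpleGraph (Fin n) → ℝ) : ℝ :=
  ∑ G, μ G * f G

/-- Variance of a graph statistic under a probability mass function on graphs. -/
noncomputable def graphVar {n : ℕ} (μ f : SimpleGraph (Fin n) → ℝ) : ℝ :=
  graphMean μ fun G => (f G - graphMean μ f) ^ 2

/-- The sequence of real-valued statistics `f n` distinguishes `μ n` from `ν n` with high
probability: the gap between its means is of strictly larger order, `ω(·)`, than its standard
deviations under both laws. -/
def Distinguishes (μ ν f : (n : ℕ) → SimpleGraph (Fin n) → ℝ) : Prop :=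
  ∀ C : ℝ, ∀ᶠ n in Filter.atTop,
    C * √(max (graphVar (μ n) (f n)) (graphVar (ν n) (f n))) <
      |graphMean (μ n) (f n) - graphMean (ν n) (f n)|

open Classical in
/-- `f` is a polynomial of degree at most `D` in the edge indicators of the graph. -/
def IsPolynomialTest {n : ℕ} (D : ℕ) (f : SimpleGraph (Fin n) → ℝ) : Prop :=
  ∃ P : MvPolynomial (⊤ : SimpleGraph (Fin n)).edgeSet ℝ, P.totalDegree ≤ D ∧
    ∀ G, f G = MvPolynomial.eval
      (fun e : (⊤ : SimpleGraph (Fin n)).edgeSet => if (e : Sym2 (Fin n)) ∈ G.edgeSet then (1 : ℝ) else 0) P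

open Classical in
/-- Signed count of `H` (a graph without isolated vertices) in `G`: the sum, over all copies `K` of
`H` in the complete graph on `Fin n`, of the product over the edges of `K` of `1` for an edge of `G`
and `-1` for a non-edge. Each copy is counted once. -/
noncomputable def signedCount {V : Type} [Fintype V] (H : SimpleGraph V) {n : ℕ}
    (G : SimpleGraph (Fin n)) : ℝ :=
  ∑ K ∈ (Finset.univ : Finset (V ↪ Fin n)).image (fun φ : V ↪ Fin n => H.map φ),
    ∏ e ∈ K.edgeFinset, if e ∈ G.edgeSet then (1 : ℝ) else -1

/-- The star with `t` edges. -/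
def starWithEdges (t : ℕ) : SimpleGraph (Fin (t + 1)) :=
  SimpleGraph.starGraph 0

/-!
# Testing two-community block models with 4-cycles and stars

Write `d` for the mean signed degree of a vertex given its label, and centre the labels. The kernel
of a two-community model is then `Q(x, y) = a + β (ψ x + ψ y) + γ ψ x ψ y`, where `ψ` has mean zero
and all higher moments of `ψ` are at most `π = p₀ p₁`. The *scale* of the model is the number `ε`
given by the largest of `|Φ(H)| ^ (1 / v(H))`, where `Φ(H)` is the Fourier coefficient of `H`, and
`H` runs over the 4-cycle and the stars with `1`, `2` and `D` edges. These coefficients control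
`πγ`, `a`, `πβ²` and `πβ ^ D` respectively; evenness of `D` excludes cancellation between the two
communities in the last one.

*Every small graph is governed by the scale* (`SBM.abs_fourier_le`). Expanding all edges of a graph
in `ψ`, a term survives only if every vertex carries no factor `ψ` or at least two. A vertex with
`b` linear and `c` bilinear factors has weight `π |β| ^ b |γ| ^ (c / 2)`, and interpolation between
the four bounds shows that this is at most of order `ε ^ (1 + b')` for all `b' ≤ min b D`: it pays
for itself and for `b'` neighbours that carry no factor. Hence `|Φ(S)|` is of order
`ε ^ v(S)` as soon as no vertex has to pay for more than `D` neighbours.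

*Tests force a large scale* (`tendsto_scale_of_distinguishes`). By Cauchy–Schwarz a polynomial of
degree at most `D` can only distinguish the models if the sum of `Φ(S) ^ 2` over the nonempty edge
sets with at most `D` edges is unbounded. Grouping the edge sets by the vertices they touch bounds
this sum by a polynomial in `n ε²`, so that `n ε² → ∞`.

*The graph attaining the scale is a test* (`SBM.OverlapBound.lt_abs_mean_sub`). Let `H` on `v`
vertices satisfy `|Φ(H)| = ε ^ v`. The mean of its signed count is of order `(n ε) ^ v`. In the
variance only pairs of copies sharing `r ≥ 1` vertices matter. Their symmetric difference touches
at least `2 v - 2 r` vertices, so such a pair contributes about `ε ^ (2 v - 2 r)`, and all of them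
together `(n ε) ^ (2 v) (n ε²) ^ (-r)`, which is negligible. For the star with `D` edges, two copies
with a common centre may differ by a star with more than `D` edges, to which the general bound does
not apply; there the moments of `d` are compared directly (`SBM.degMoment_le_of_star`), and this is
where `n min(p₀, p₁) → ∞` is used.
-/

section
open Classical Finset

/-! ### Fourier characters on graphs -/

/-- The potential edges of a graph on `Fin n`. -/
def allPairs (n : ℕ) : Finset (Sym2 (Fin n)) := univ.filter fun e => ¬ e.IsDiag

theorem mem_allPairs {n : ℕ} {e : Sym2 (Fin n)} : e ∈ allPairs n ↔ ¬ e.IsDiag := by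
  simp [allPairs]

/-- The Fourier character of the hypercube of graphs indexed by the edge set `S`: the product over
`S` of the signed edge indicators. -/
noncomputable def signChar {n : ℕ} (S : Finset (Sym2 (Fin n))) (G : SimpleGraph (Fin n)) : ℝ :=
  ∏ e ∈ S, if e ∈ G.edgeSet then (1 : ℝ) else -1

/-- The connection coefficient `Q (x i) (x j)` of the pair `s(i, j)` under the labelling `x`. -/
def SBM.pairQ {k : ℕ} (M : SBM k) {V : Type*} (x : V → Fin k) : Sym2 V → ℝ :=
  Sym2.lift ⟨fun i j => M.Q (x i) (x j), fun _ _ => M.Q_symm.apply _ _⟩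

@[simp] theorem SBM.pairQ_mk {k : ℕ} (M : SBM k) {V : Type*} (x : V → Fin k) (i j : V) :
    M.pairQ x s(i, j) = M.Q (x i) (x j) := rfl

/-- The Fourier coefficient of the block model at the edge set `S`, as an average over labels. -/
noncomputable def SBM.fourier {k : ℕ} (M : SBM k) {V : Type*} [Fintype V] [DecidableEq V]
    (S : Finset (Sym2 V)) : ℝ :=
  ∑ x : V → Fin k, (∏ i, M.p (x i)) * ∏ e ∈ S, M.pairQ x e

theorem prod_Ioi_eq_prod_allPairs {n : ℕ} (F : Sym2 (Fin n) → ℝ) :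
    ∏ i, ∏ j ∈ Finset.Ioi i, F s(i, j) = ∏ e ∈ allPairs n, F e := by
  rw [Finset.prod_sigma']
  refine Finset.prod_bij (fun a _ => s(a.1, a.2)) ?_ ?_ ?_ ?_
  · rintro ⟨i, j⟩ h
    simp only [mem_sigma, mem_univ, mem_Ioi, true_and] at h
    simp [mem_allPairs, h.ne]
  · rintro ⟨i, j⟩ h ⟨i', j'⟩ h' heq
    simp only [mem_sigma, mem_univ, mem_Ioi, true_and] at h h'
    rw [Sym2.eq_iff] at heq
    rcases heq with ⟨rfl, rfl⟩ | ⟨rfl, rfl⟩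
    · rfl
    · exact absurd h (not_lt.2 h'.le)
  · intro e he
    induction e using Sym2.ind with
    | _ i j =>
      have hij : i ≠ j := by simpa [mem_allPairs] using he
      rcases lt_or_gt_of_ne hij with h | h
      · exact ⟨⟨i, j⟩, by simp [h], rfl⟩
      · exact ⟨⟨j, i⟩, by simp [h], Sym2.eq_swap⟩
  · intro _ _
    rfl

theorem sum_graph_prod {n : ℕ} (A B : Sym2 (Fin n) → ℝ) :
    ∑ G : SimpleGraph (Fin n), ∏ e ∈ allPairs n, (if e ∈ G.edgeSet then A e else B e) =
      ∏ e ∈ allPairs n, (A e + B e) := by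
  rw [Finset.prod_add]
  refine Finset.sum_bij' (fun G _ => (allPairs n).filter (· ∈ G.edgeSet))
    (fun S _ => SimpleGraph.fromEdgeSet (S : Set (Sym2 (Fin n)))) ?_ ?_ ?_ ?_ ?_
  · intro G _
    simp
  · intro S _
    exact mem_univ _
  · intro G _
    have : (((allPairs n).filter (· ∈ G.edgeSet) : Finset _) : Set (Sym2 (Fin n))) = G.edgeSet := by
      ext e
      simp only [coe_filter, mem_allPairs, Set.mem_ofPred_eq, and_iff_right_iff_imp]
      exact fun h => G.not_isDiag_of_mem_edgeSet h
    rw [this, SimpleGraph.fromEdgeSet_edgeSet]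
  · intro S hS
    ext e
    rw [mem_powerset] at hS
    simp only [SimpleGraph.edgeSet_fromEdgeSet, mem_filter, Set.mem_sdiff, mem_coe]
    refine ⟨fun h => h.2.1, fun h => ⟨hS h, h, ?_⟩⟩
    have := mem_allPairs.1 (hS h)
    simpa using this
  · intro G _
    rw [Finset.prod_ite, Finset.filter_not]

/-- Against a product measure with edge biases `q`, the character of `S` has mean `∏ e ∈ S, q e`. -/
theorem sum_graph_bias_mul_signChar {n : ℕ} (q : Sym2 (Fin n) → ℝ) {S : Finset (Sym2 (Fin n))}
    (hS : S ⊆ allPairs n) :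
    ∑ G : SimpleGraph (Fin n), (∏ e ∈ allPairs n,
      (if e ∈ G.edgeSet then (1 + q e) / 2 else 1 - (1 + q e) / 2)) * signChar S G =
      ∏ e ∈ S, q e := by
  have key : ∀ G : SimpleGraph (Fin n), (∏ e ∈ allPairs n,
      (if e ∈ G.edgeSet then (1 + q e) / 2 else 1 - (1 + q e) / 2)) * signChar S G =
      ∏ e ∈ allPairs n, (if e ∈ G.edgeSet then (1 + q e) / 2
        else (1 - (1 + q e) / 2) * (if e ∈ S then -1 else 1)) := by
    intro G
    rw [signChar, ← Finset.prod_filter_mul_prod_filter_not (allPairs n) (· ∈ S)]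
    have h1 : (allPairs n).filter (· ∈ S) = S := by
      ext e; simp only [mem_filter]; exact ⟨fun h => h.2, fun h => ⟨hS h, h⟩⟩
    rw [← Finset.prod_filter_mul_prod_filter_not (allPairs n) (· ∈ S) (fun e =>
      if e ∈ G.edgeSet then (1 + q e) / 2
        else (1 - (1 + q e) / 2) * (if e ∈ S then -1 else 1)), h1, mul_right_comm,
      ← Finset.prod_mul_distrib]
    congr 1
    · refine Finset.prod_congr rfl fun e he => ?_
      simp only [he, if_true]
      split_ifs <;> simp
    · refine Finset.prod_congr rfl fun e he => ?_
      simp only [(mem_filter.1 he).2, if_false, mul_one]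
  simp_rw [key]
  rw [sum_graph_prod, ← Finset.prod_subset hS]
  · refine Finset.prod_congr rfl fun e he => ?_
    simp only [he, if_true]; ring
  · intro e _ he
    simp only [he, if_false]; ring

theorem SBM.law_eq {k : ℕ} (M : SBM k) (n : ℕ) (G : SimpleGraph (Fin n)) :
    M.law n G = ∑ x : Fin n → Fin k, (∏ i, M.p (x i)) * ∏ e ∈ allPairs n,
      (if e ∈ G.edgeSet then (1 + M.pairQ x e) / 2 else 1 - (1 + M.pairQ x e) / 2) := by
  refine Finset.sum_congr rfl fun x _ => ?_
  rw [← prod_Ioi_eq_prod_allPairs]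
  rfl

theorem erdosRenyiLaw_half_eq (n : ℕ) (G : SimpleGraph (Fin n)) :
    erdosRenyiLaw (1 / 2) n G = ∏ e ∈ allPairs n,
      (if e ∈ G.edgeSet then (1 + (0 : ℝ)) / 2 else 1 - (1 + (0 : ℝ)) / 2) := by
  rw [← prod_Ioi_eq_prod_allPairs (fun e =>
    if e ∈ G.edgeSet then (1 + (0 : ℝ)) / 2 else 1 - (1 + (0 : ℝ)) / 2)]
  simp only [erdosRenyiLaw, add_zero, SimpleGraph.mem_edgeSet]

theorem graphMean_law_signChar {k : ℕ} (M : SBM k) {n : ℕ} {S : Finset (Sym2 (Fin n))}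
    (hS : S ⊆ allPairs n) : graphMean (M.law n) (signChar S) = M.fourier S := by
  simp only [graphMean, SBM.law_eq, Finset.sum_mul]
  rw [Finset.sum_comm]
  refine Finset.sum_congr rfl fun x _ => ?_
  rw [← sum_graph_bias_mul_signChar (M.pairQ x) hS, Finset.mul_sum]
  exact Finset.sum_congr rfl fun G _ => by ring

theorem graphMean_erdosRenyi_signChar {n : ℕ} {S : Finset (Sym2 (Fin n))}
    (hS : S ⊆ allPairs n) :
    graphMean (erdosRenyiLaw (1 / 2) n) (signChar S) = if S = ∅ then 1 else 0 := by
  simp only [graphMean, erdosRenyiLaw_half_eq]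
  rw [sum_graph_bias_mul_signChar (fun _ => 0) hS, Finset.prod_const]
  split_ifs with h
  · simp [h]
  · rw [zero_pow (by simpa using h)]

theorem signChar_mul_signChar {n : ℕ} (S T : Finset (Sym2 (Fin n))) (G : SimpleGraph (Fin n)) :
    signChar S G * signChar T G = signChar (symmDiff S T) G := by
  have hsq : ∀ U : Finset (Sym2 (Fin n)), signChar U G * signChar U G = 1 := by
    intro U
    rw [signChar, ← Finset.prod_mul_distrib]
    exact Finset.prod_eq_one fun e _ => by split_ifs <;> norm_num
  have h1 : signChar S G = signChar (S \ T) G * signChar (S ∩ T) G := by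
    rw [signChar, signChar, signChar, mul_comm, Finset.prod_inter_mul_prod_sdiff]
  have h2 : signChar T G = signChar (T \ S) G * signChar (S ∩ T) G := by
    rw [signChar, signChar, signChar, mul_comm, Finset.inter_comm, Finset.prod_inter_mul_prod_sdiff]
  have h3 : signChar (symmDiff S T) G = signChar (S \ T) G * signChar (T \ S) G := by
    rw [signChar, symmDiff_def, Finset.sup_eq_union, Finset.prod_union]
    · rfl
    · exact disjoint_sdiff_sdiff
  rw [h1, h2, h3, mul_mul_mul_comm, hsq, mul_one]

theorem symmDiff_subset_allPairs {n : ℕ} {S T : Finset (Sym2 (Fin n))}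
    (hS : S ⊆ allPairs n) (hT : T ⊆ allPairs n) : symmDiff S T ⊆ allPairs n := by
  intro e he
  rw [Finset.mem_symmDiff] at he
  rcases he with h | h
  · exact hS h.1
  · exact hT h.1

theorem graphMean_add {n : ℕ} (μ f g : SimpleGraph (Fin n) → ℝ) :
    graphMean μ (fun G => f G + g G) = graphMean μ f + graphMean μ g := by
  simp [graphMean, mul_add, Finset.sum_add_distrib]

theorem graphMean_const_mul {n : ℕ} (μ f : SimpleGraph (Fin n) → ℝ) (c : ℝ) :
    graphMean μ (fun G => c * f G) = c * graphMean μ f := by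
  simp [graphMean, Finset.mul_sum, mul_left_comm]

theorem graphMean_sum {n : ℕ} {ι : Type*} (s : Finset ι) (μ : SimpleGraph (Fin n) → ℝ)
    (f : ι → SimpleGraph (Fin n) → ℝ) :
    graphMean μ (fun G => ∑ a ∈ s, f a G) = ∑ a ∈ s, graphMean μ (f a) := by
  simp only [graphMean, Finset.mul_sum]
  exact Finset.sum_comm

theorem signChar_empty {n : ℕ} (G : SimpleGraph (Fin n)) : signChar ∅ G = 1 := rfl

theorem SBM.fourier_empty {k : ℕ} (M : SBM k) (V : Type*) [Fintype V] [DecidableEq V] :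
    M.fourier (∅ : Finset (Sym2 V)) = 1 := by
  simp only [SBM.fourier, Finset.prod_empty, mul_one]
  rw [← Fintype.prod_sum]
  simp [M.p_sum]

/-- Variance expands as the second moment minus the squared mean. -/
theorem graphVar_eq {n : ℕ} {μ : SimpleGraph (Fin n) → ℝ} (hμ : ∑ G, μ G = 1)
    (f : SimpleGraph (Fin n) → ℝ) :
    graphVar μ f = graphMean μ (fun G => f G * f G) - graphMean μ f ^ 2 := by
  have : ∀ m : ℝ, graphMean μ (fun G => (f G - m) ^ 2) =
      graphMean μ (fun G => f G * f G) - 2 * m * graphMean μ f + m ^ 2 := by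
    intro m
    have h : ∀ G, μ G * (f G - m) ^ 2 = μ G * (f G * f G) - 2 * m * (μ G * f G) + m ^ 2 * μ G := by
      intro G; ring
    simp only [graphMean, h, Finset.sum_add_distrib, Finset.sum_sub_distrib, ← Finset.mul_sum, hμ,
      mul_one]
  rw [graphVar, this]; ring

theorem sum_law {k : ℕ} (M : SBM k) (n : ℕ) : ∑ G, M.law n G = 1 := by
  have := graphMean_law_signChar M (n := n) (S := ∅) (by simp)
  simpa [graphMean, signChar_empty, SBM.fourier_empty] using this

theorem sum_erdosRenyiLaw_half (n : ℕ) : ∑ G, erdosRenyiLaw (1 / 2) n G = 1 := by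
  have := graphMean_erdosRenyi_signChar (n := n) (S := ∅) (by simp)
  simpa [graphMean, signChar_empty] using this

theorem erdosRenyiLaw_half_nonneg (n : ℕ) (G : SimpleGraph (Fin n)) :
    0 ≤ erdosRenyiLaw (1 / 2) n G := by
  rw [erdosRenyiLaw_half_eq]
  exact Finset.prod_nonneg fun e _ => by split_ifs <;> norm_num

end

section
open Finset

/-! ### The bilinear form of a two-community block model -/

namespace SBM

variable (M : SBM 2)

/-- The variance scale `p₀ p₁` of the label distribution. -/
def labelVar : ℝ := M.p 0 * M.p 1

/-- The centred label, equal to `p₁` on community `0` and `-p₀` on community `1`. -/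
def centred : Fin 2 → ℝ := ![M.p 1, -M.p 0]

/-- The normalised expected signed degree of a vertex of community `c`. -/
def meanDeg (c : Fin 2) : ℝ := ∑ b, M.p b * M.Q c b

/-- The mean of `Q` under two independent labels. -/
def edgeMean : ℝ := ∑ c, M.p c * M.meanDeg c

/-- The coefficient of the two linear terms in the expansion of `Q` in centred labels. -/
def slope : ℝ := M.meanDeg 0 - M.meanDeg 1

/-- The coefficient of the bilinear term in the expansion of `Q` in centred labels. -/
def curvature : ℝ := M.Q 0 0 - 2 * M.Q 0 1 + M.Q 1 1

theorem p_one_eq : M.p 1 = 1 - M.p 0 := by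
  have := M.p_sum
  rw [Fin.sum_univ_two] at this
  linarith

theorem Q_one_zero : M.Q 1 0 = M.Q 0 1 := M.Q_symm.apply _ _

theorem Q_eq (c b : Fin 2) : M.Q c b = M.edgeMean +
    M.slope * (M.centred c + M.centred b) + M.curvature * (M.centred c * M.centred b) := by
  have h1 := M.p_one_eq
  have h2 := M.Q_one_zero
  fin_cases c <;> fin_cases b <;>
    simp [edgeMean, slope, curvature, meanDeg, centred, Fin.sum_univ_two, h1, h2] <;> ring

theorem meanDeg_eq (c : Fin 2) : M.meanDeg c = M.edgeMean + M.slope * M.centred c := by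
  have h1 := M.p_one_eq
  have h2 := M.Q_one_zero
  fin_cases c <;>
    simp [edgeMean, slope, meanDeg, centred, Fin.sum_univ_two, h1, h2] <;> ring

theorem labelVar_nonneg : 0 ≤ M.labelVar := mul_nonneg (M.p_nonneg _) (M.p_nonneg _)

theorem p_le_one (c : Fin 2) : M.p c ≤ 1 := by
  have h0 := M.p_nonneg 0
  have h1 := M.p_nonneg 1
  have h := M.p_one_eq
  fin_cases c
  · show M.p 0 ≤ 1
    linarith
  · show M.p 1 ≤ 1
    linarith

theorem abs_meanDeg_le (c : Fin 2) : |M.meanDeg c| ≤ 1 := by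
  calc |M.meanDeg c| ≤ ∑ b, |M.p b * M.Q c b| := Finset.abs_sum_le_sum_abs _ _
    _ ≤ ∑ b, M.p b := Finset.sum_le_sum fun b _ => by
        rw [abs_mul, abs_of_nonneg (M.p_nonneg b)]
        exact mul_le_of_le_one_right (M.p_nonneg b) (M.Q_abs_le c b)
    _ = 1 := M.p_sum

theorem abs_slope_le : |M.slope| ≤ 2 := by
  have h0 := M.abs_meanDeg_le 0
  have h1 := M.abs_meanDeg_le 1
  rw [abs_le] at *
  constructor <;> rw [slope] <;> linarith

theorem abs_curvature_le : |M.curvature| ≤ 4 := by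
  have h0 := M.Q_abs_le 0 0
  have h1 := M.Q_abs_le 0 1
  have h2 := M.Q_abs_le 1 1
  rw [abs_le] at *
  constructor <;> rw [curvature] <;> linarith

theorem sum_p_mul_centred_pow_one : ∑ c, M.p c * M.centred c ^ 1 = 0 := by
  simp [Fin.sum_univ_two, centred]; ring

/-- Moments of the centred label of order at least two are at most `p₀ p₁`. -/
theorem abs_sum_p_mul_centred_pow_le {k : ℕ} (hk : 2 ≤ k) :
    |∑ c, M.p c * M.centred c ^ k| ≤ M.labelVar := by
  obtain ⟨l, rfl⟩ : ∃ l, k = l + 2 := ⟨k - 2, by omega⟩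
  have h0 := M.p_nonneg 0
  have h1 := M.p_nonneg 1
  have hs := M.p_one_eq
  have e : ∑ c, M.p c * M.centred c ^ (l + 2) = M.labelVar *
      (M.p 1 * M.p 1 ^ l + M.p 0 * (-M.p 0) ^ l) := by
    simp [Fin.sum_univ_two, centred, labelVar]; ring
  rw [e, abs_mul, abs_of_nonneg M.labelVar_nonneg]
  refine mul_le_of_le_one_right M.labelVar_nonneg ?_
  calc |M.p 1 * M.p 1 ^ l + M.p 0 * (-M.p 0) ^ l|
      ≤ |M.p 1 * M.p 1 ^ l| + |M.p 0 * (-M.p 0) ^ l| := abs_add_le _ _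
    _ = M.p 1 * M.p 1 ^ l + M.p 0 * M.p 0 ^ l := by
        simp [abs_mul, abs_pow, abs_of_nonneg h0, abs_of_nonneg h1]
    _ ≤ M.p 1 * 1 + M.p 0 * 1 := by
        gcongr
        · exact pow_le_one₀ h1 (M.p_le_one 1)
        · exact pow_le_one₀ h0 (M.p_le_one 0)
    _ = 1 := by linarith

/-- The model has scale at most `ε`: a graph on `v` vertices with small degrees has a Fourier
coefficient of order at most `ε ^ v`. The four bounds are those forced by the single edge, the
cherry, the star with `D` edges and the 4-cycle. -/
structure ScaleBound (D : ℕ) (ε : ℝ) : Prop where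
  nonneg : 0 ≤ ε
  le_one : ε ≤ 1
  edge : |M.edgeMean| ≤ ε ^ 2
  cherry : M.labelVar * M.slope ^ 2 ≤ ε ^ 3
  star : M.labelVar * |M.slope| ^ D ≤ 2 ^ D * ε ^ (D + 1)
  cycle : M.labelVar * |M.curvature| ≤ ε

end SBM

/-! ### Fourier coefficients are controlled by the scale -/

theorem mul_pow_interpolate {π B ε K : ℝ} {D t : ℕ} (hB : 0 ≤ B) (hε : 0 ≤ ε)
    (hK : 1 ≤ K) (h2 : π * B ^ 2 ≤ ε ^ 3) (hD : π * B ^ D ≤ K * ε ^ (D + 1)) (ht : 2 ≤ t)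
    (htD : t ≤ D) : π * B ^ t ≤ K * ε ^ (t + 1) := by
  rcases le_or_gt B ε with h | h
  · obtain ⟨l, rfl⟩ : ∃ l, t = 2 + l := ⟨t - 2, by omega⟩
    calc π * B ^ (2 + l) = π * B ^ 2 * B ^ l := by ring
      _ ≤ ε ^ 3 * ε ^ l := by gcongr
      _ = 1 * ε ^ (2 + l + 1) := by ring
      _ ≤ K * ε ^ (2 + l + 1) := by gcongr
  · obtain ⟨l, rfl⟩ : ∃ l, D = t + l := ⟨D - t, by omega⟩
    have hB' : 0 < B := lt_of_le_of_lt hε h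
    have hBl : 0 < B ^ l := pow_pos hB' l
    refine le_of_mul_le_mul_right ?_ hBl
    calc π * B ^ t * B ^ l = π * B ^ (t + l) := by ring
      _ ≤ K * ε ^ (t + l + 1) := hD
      _ = K * ε ^ (t + 1) * ε ^ l := by ring
      _ ≤ K * ε ^ (t + 1) * B ^ l := by gcongr

/-- The contribution of a vertex carrying `b` linear and `c` bilinear factors pays for itself and
for `b' ≤ min b D` further vertices. -/
theorem vertex_weight_le {π B g ε : ℝ} {D b c b' : ℕ} (hπ : 0 ≤ π) (hB : 0 ≤ B) (hB2 : B ≤ 2)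
    (hg : 0 ≤ g) (hg2 : g ≤ 2) (hε : 0 ≤ ε) (hε1 : ε ≤ 1) (h2 : π * B ^ 2 ≤ ε ^ 3)
    (hD : π * B ^ D ≤ 2 ^ D * ε ^ (D + 1)) (hγ : π * g ^ 2 ≤ ε) (hD2 : 2 ≤ D)
    (hbc : 2 ≤ b + c) (hb : b' ≤ b) (hbD : b' ≤ D) :
    π * (B ^ b * g ^ c) ≤ (2 ^ (D + 1)) ^ (b + c) * ε ^ (1 + b') := by
  have hK : (2 : ℝ) ^ D * 2 ^ (b + c) ≤ (2 ^ (D + 1)) ^ (b + c) := by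
    rw [pow_succ, mul_pow]
    gcongr
    exact le_self_pow₀ (one_le_pow₀ (by norm_num)) (by omega)
  have h1D : (1 : ℝ) ≤ 2 ^ D := one_le_pow₀ (by norm_num)
  suffices h : π * (B ^ b * g ^ c) ≤ 2 ^ D * 2 ^ (b + c) * ε ^ (1 + b') by
    refine h.trans ?_
    gcongr
  rcases Nat.lt_or_ge b 2 with hb2 | hb2
  · interval_cases b
    · obtain ⟨l, rfl⟩ : ∃ l, c = 2 + l := ⟨c - 2, by omega⟩
      obtain rfl : b' = 0 := by omega
      calc π * (B ^ 0 * g ^ (2 + l)) = π * g ^ 2 * g ^ l := by ring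
        _ ≤ ε * 2 ^ l := by gcongr
        _ = 1 * (1 * 2 ^ l) * ε := by ring
        _ ≤ 2 ^ D * (2 ^ 2 * 2 ^ l) * ε := by gcongr; norm_num
        _ = 2 ^ D * 2 ^ (0 + (2 + l)) * ε ^ (1 + 0) := by ring
    · obtain ⟨l, rfl⟩ : ∃ l, c = 1 + l := ⟨c - 1, by omega⟩
      have hsq : π * B * g ≤ ε ^ 2 := by
        refine le_of_sq_le_sq ?_ (by positivity)
        calc (π * B * g) ^ 2 = (π * B ^ 2) * (π * g ^ 2) := by ring
          _ ≤ ε ^ 3 * ε := by gcongr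
          _ = (ε ^ 2) ^ 2 := by ring
      calc π * (B ^ 1 * g ^ (1 + l)) = π * B * g * g ^ l := by ring
        _ ≤ ε ^ 2 * 2 ^ l := by gcongr
        _ ≤ ε ^ (1 + b') * 2 ^ l := by
            gcongr ?_ * _
            exact pow_le_pow_of_le_one hε hε1 (by omega)
        _ = 1 * (1 * 2 ^ l) * ε ^ (1 + b') := by ring
        _ ≤ 2 ^ D * (2 ^ 2 * 2 ^ l) * ε ^ (1 + b') := by gcongr; norm_num
        _ = 2 ^ D * 2 ^ (1 + (1 + l)) * ε ^ (1 + b') := by ring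
  · obtain ⟨l, rfl⟩ : ∃ l, b = max b' 2 + l := ⟨b - max b' 2, by omega⟩
    have h3 := mul_pow_interpolate (t := max b' 2) hB hε h1D h2 hD (by omega) (by omega)
    calc π * (B ^ (max b' 2 + l) * g ^ c) = π * B ^ (max b' 2) * (B ^ l * g ^ c) := by ring
      _ ≤ 2 ^ D * ε ^ (max b' 2 + 1) * (2 ^ l * 2 ^ c) := by gcongr
      _ ≤ 2 ^ D * ε ^ (1 + b') * (2 ^ (max b' 2 + l) * 2 ^ c) := by
          gcongr 2 ^ D * ?_ * (?_ * _)
          · exact pow_le_pow_of_le_one hε hε1 (by omega)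
          · exact pow_le_pow_right₀ (by norm_num) (by omega)
      _ = 2 ^ D * 2 ^ (max b' 2 + l + c) * ε ^ (1 + b') := by ring

end

section
open Finset

/-- Weight of a half-edge in the expansion of the model, depending on whether it and its partner
carry a centred label: an edge contributes the product of the weights of its two halves, which is
the absolute value of the constant, linear or bilinear coefficient. -/
noncomputable def SBM.halfWeight (M : SBM 2) : Bool → Bool → ℝ
  | false, false => √|M.edgeMean|
  | true, false => |M.slope|
  | false, true => 1
  | true, true => √|M.curvature|

/-- Coefficient of the expansion of an edge in the centred labels of its two endpoints. -/
def SBM.edgeCoeff (M : SBM 2) : Bool → Bool → ℝ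
  | false, false => M.edgeMean
  | true, false => M.slope
  | false, true => M.slope
  | true, true => M.curvature

theorem SBM.abs_edgeCoeff (M : SBM 2) (s t : Bool) :
    |M.edgeCoeff s t| = M.halfWeight s t * M.halfWeight t s := by
  cases s <;> cases t <;> simp [SBM.edgeCoeff, SBM.halfWeight]

theorem SBM.halfWeight_nonneg (M : SBM 2) (s t : Bool) : 0 ≤ M.halfWeight s t := by
  cases s <;> cases t <;> simp [SBM.halfWeight]

theorem SBM.Q_eq_sum (M : SBM 2) (c b : Fin 2) : M.Q c b = ∑ f : Bool → Bool,
    M.edgeCoeff (f false) (f true) *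
      ∏ s, (M.centred (bif s then b else c)) ^ (f s).toNat := by
  rw [← Equiv.sum_comp (Equiv.boolArrowEquivProd Bool).symm, Fintype.sum_prod_type, M.Q_eq c b]
  simp [Equiv.boolArrowEquivProd, SBM.edgeCoeff]
  ring

/-- The other half of an edge. -/
def flipHalf {E : Type*} (h : E × Bool) : E × Bool := (h.1, !h.2)

theorem flipHalf_flipHalf {E : Type*} (h : E × Bool) : flipHalf (flipHalf h) = h := by
  simp [flipHalf]

variable {V E : Type*} [Fintype V] [DecidableEq V] [Fintype E] [DecidableEq E]

/-- The number of half-edges at `i` that carry a centred label. -/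
def flagCount (v : E × Bool → V) (τ : E → Bool → Bool) (i : V) : ℕ :=
  #{h : E × Bool | v h = i ∧ τ h.1 h.2 = true}

/-- The expansion of a multigraph moment over choices of a coefficient for every edge; the
sum over labels factorises over the vertices. -/
theorem SBM.moment_eq_sum (M : SBM 2) (v : E × Bool → V) :
    ∑ x : V → Fin 2, (∏ i, M.p (x i)) * ∏ e : E, M.Q (x (v (e, false))) (x (v (e, true))) =
      ∑ τ : E → Bool → Bool, (∏ e, M.edgeCoeff (τ e false) (τ e true)) *
        ∏ i, ∑ c, M.p c * M.centred c ^ flagCount v τ i := by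
  have hx : ∀ x : V → Fin 2, ∏ e : E, M.Q (x (v (e, false))) (x (v (e, true))) =
      ∑ τ : E → Bool → Bool, (∏ e, M.edgeCoeff (τ e false) (τ e true)) *
        ∏ i, M.centred (x i) ^ flagCount v τ i := by
    intro x
    simp_rw [M.Q_eq_sum]
    rw [Fintype.prod_sum]
    refine Finset.sum_congr rfl fun τ _ => ?_
    rw [Finset.prod_mul_distrib]
    congr 1
    have h1 : ∀ e : E, ∏ s, M.centred (bif s then x (v (e, true)) else x (v (e, false))) ^
        (τ e s).toNat = ∏ s, M.centred (x (v (e, s))) ^ (τ e s).toNat := by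
      intro e; simp
    simp_rw [h1]
    rw [← Fintype.prod_prod_type (fun h : E × Bool => M.centred (x (v h)) ^ (τ h.1 h.2).toNat),
      ← Finset.prod_fiberwise univ v]
    refine Finset.prod_congr rfl fun i _ => ?_
    rw [flagCount, ← Finset.filter_filter, Finset.card_filter, ← Finset.prod_pow_eq_pow_sum]
    refine Finset.prod_congr rfl fun h hh => ?_
    rw [(Finset.mem_filter.1 hh).2]
    cases τ h.1 h.2 <;> rfl
  simp_rw [hx, Finset.mul_sum]
  rw [Finset.sum_comm]
  refine Finset.sum_congr rfl fun τ _ => ?_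
  rw [Fintype.prod_sum, Finset.mul_sum]
  refine Finset.sum_congr rfl fun x _ => ?_
  rw [Finset.prod_mul_distrib]
  ring

omit [DecidableEq E] in
/-- The absolute value of one term of the expansion, distributed over the vertices. -/
theorem SBM.abs_term_eq (M : SBM 2) (v : E × Bool → V) (τ : E → Bool → Bool) :
    |(∏ e, M.edgeCoeff (τ e false) (τ e true)) *
        ∏ i, ∑ c, M.p c * M.centred c ^ flagCount v τ i| =
      ∏ i, (|∑ c, M.p c * M.centred c ^ flagCount v τ i| *
        ∏ h : E × Bool with v h = i,
          M.halfWeight (τ h.1 h.2) (τ (flipHalf h).1 (flipHalf h).2)) := by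
  rw [abs_mul, Finset.abs_prod, Finset.abs_prod, Finset.prod_mul_distrib, mul_comm]
  congr 1
  rw [Finset.prod_fiberwise, Fintype.prod_prod_type]
  refine Finset.prod_congr rfl fun e _ => ?_
  rw [M.abs_edgeCoeff]
  simp [flipHalf, mul_comm]

omit [Fintype V] [DecidableEq E] in
theorem SBM.prod_halfWeight_le {M : SBM 2} {D : ℕ} {ε : ℝ} (hM : M.ScaleBound D ε)
    (v : E × Bool → V) (τ : E → Bool → Bool) (i : V) :
    ∏ h : E × Bool with v h = i, M.halfWeight (τ h.1 h.2) (τ (flipHalf h).1 (flipHalf h).2) ≤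
      |M.slope| ^ #{h : E × Bool | v h = i ∧ τ h.1 h.2 = true ∧
          τ (flipHalf h).1 (flipHalf h).2 = false} *
      √|M.curvature| ^ #{h : E × Bool | v h = i ∧ τ h.1 h.2 = true ∧
          τ (flipHalf h).1 (flipHalf h).2 = true} := by
  have hα : |M.edgeMean| ≤ 1 := hM.edge.trans (pow_le_one₀ hM.nonneg hM.le_one)
  have h1 : ∀ (P : E × Bool → Prop) [DecidablePred P] (r : ℝ),
      r ^ #{h : E × Bool | v h = i ∧ P h} = ∏ h : E × Bool with v h = i, if P h then r else 1 := by
    intro P _ r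
    rw [← Finset.filter_filter, Finset.prod_ite, Finset.prod_const, Finset.prod_const_one, mul_one]
  rw [h1, h1, ← Finset.prod_mul_distrib]
  refine Finset.prod_le_prod (fun h _ => M.halfWeight_nonneg _ _) fun h _ => ?_
  cases τ h.1 h.2 <;> cases τ (flipHalf h).1 (flipHalf h).2 <;>
    simp [SBM.halfWeight, hα]


omit [Fintype V] [DecidableEq E] in
theorem flagCount_eq_add (v : E × Bool → V) (τ : E → Bool → Bool) (i : V) :
    flagCount v τ i =
      #{h : E × Bool | v h = i ∧ τ h.1 h.2 = true ∧ τ (flipHalf h).1 (flipHalf h).2 = false} +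
      #{h : E × Bool | v h = i ∧ τ h.1 h.2 = true ∧ τ (flipHalf h).1 (flipHalf h).2 = true} := by
  rw [flagCount, ← Finset.card_filter_add_card_filter_not
    (fun h : E × Bool => τ (flipHalf h).1 (flipHalf h).2 = false), Finset.filter_filter,
    Finset.filter_filter]
  simp only [and_assoc, Bool.not_eq_false]

omit [Fintype V] [DecidableEq E] in
/-- A vertex carrying `k ≥ 2` centred labels pays for itself and for `b'` of its neighbours that
carry none. -/
theorem SBM.flagged_vertex_le {M : SBM 2} {D : ℕ} {ε : ℝ} (hM : M.ScaleBound D ε) (hD : 2 ≤ D)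
    (v : E × Bool → V) (τ : E → Bool → Bool) (i : V) (hk : 2 ≤ flagCount v τ i) {b' : ℕ}
    (hb : b' ≤ #{h : E × Bool | v h = i ∧ τ h.1 h.2 = true ∧
      τ (flipHalf h).1 (flipHalf h).2 = false}) (hbD : b' ≤ D) :
    |∑ c, M.p c * M.centred c ^ flagCount v τ i| *
        ∏ h : E × Bool with v h = i,
          M.halfWeight (τ h.1 h.2) (τ (flipHalf h).1 (flipHalf h).2) ≤
      (2 ^ (D + 1)) ^ flagCount v τ i * ε ^ (1 + b') := by
  have hg2 : √|M.curvature| ≤ 2 := by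
    rw [Real.sqrt_le_left (by norm_num)]
    exact M.abs_curvature_le.trans (by norm_num)
  calc _ ≤ M.labelVar * _ :=
        mul_le_mul (M.abs_sum_p_mul_centred_pow_le hk) (SBM.prod_halfWeight_le hM v τ i)
          (Finset.prod_nonneg fun h _ => M.halfWeight_nonneg _ _) M.labelVar_nonneg
    _ ≤ _ := by
        rw [flagCount_eq_add] at hk ⊢
        refine vertex_weight_le M.labelVar_nonneg (abs_nonneg _) M.abs_slope_le
          (Real.sqrt_nonneg _) hg2 hM.nonneg hM.le_one ?_ hM.star ?_ hD hk hb hbD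
        · rw [sq_abs]; exact hM.cherry
        · rw [Real.sq_sqrt (abs_nonneg _)]; exact hM.cycle

/-- One term of the expansion of a multigraph moment is of order `ε ^ #N`, if every vertex `u ∈ N`
comes with a half-edge `h u` at it, and no vertex is the other end of more than `D` of them.
A vertex of `N` without centred label pays through its half-edge: either the edge is constant
(and of order `ε` per half), or its other end carries a centred label and pays. -/
theorem SBM.abs_term_le {M : SBM 2} {D : ℕ} {ε : ℝ} (hM : M.ScaleBound D ε) (hD : 2 ≤ D)
    (v : E × Bool → V) (N : Finset V) (h : V → E × Bool) (hv : ∀ u ∈ N, v (h u) = u)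
    (hfib : ∀ i, #{u ∈ N | v (flipHalf (h u)) = i} ≤ D) (τ : E → Bool → Bool) :
    |(∏ e, M.edgeCoeff (τ e false) (τ e true)) *
        ∏ i, ∑ c, M.p c * M.centred c ^ flagCount v τ i| ≤
      (2 ^ (D + 1)) ^ (2 * Fintype.card E) * ε ^ #N := by
  have hε := hM.nonneg
  rw [M.abs_term_eq]
  set fl : E × Bool → Bool := fun h => τ h.1 h.2 with hfl
  set k : V → ℕ := flagCount v τ with hkdef
  let N₀ : Finset V := {u ∈ N | k u = 0 ∧ fl (flipHalf (h u)) = false}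
  let N₁ : Finset V := {u ∈ N | k u = 0 ∧ fl (flipHalf (h u)) = true}
  let b : V → ℕ := fun i => #{u ∈ N₁ | v (flipHalf (h u)) = i}
  let m : V → ℕ := fun i => (if k i = 0 then (if i ∈ N₀ then 1 else 0) else 1) + b i
  have hk0 : ∀ i, k i = 0 → ∀ e, v e = i → fl e = false := by
    intro i hi e he
    by_contra hne
    have hmem : e ∈ ({h : E × Bool | v h = i ∧ τ h.1 h.2 = true} : Finset _) := by
      simp only [Finset.mem_filter, Finset.mem_univ, true_and]
      exact ⟨he, by simpa [hfl] using hne⟩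
    have := Finset.card_pos.2 ⟨e, hmem⟩
    simp only [hkdef, flagCount] at hi
    omega
  have hb0 : ∀ i, k i = 0 → b i = 0 := by
    intro i hi
    simp only [b, Finset.card_eq_zero]
    rw [Finset.filter_eq_empty_iff]
    intro u hu hui
    have h1 := (Finset.mem_filter.1 hu).2.2
    rw [hk0 i hi _ hui] at h1
    exact absurd h1 (by simp)
  have hvert : ∀ i, |∑ c, M.p c * M.centred c ^ k i| *
        ∏ h : E × Bool with v h = i,
          M.halfWeight (τ h.1 h.2) (τ (flipHalf h).1 (flipHalf h).2) ≤
      (2 ^ (D + 1)) ^ k i * ε ^ m i := by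
    intro i
    rcases Nat.lt_or_ge (k i) 2 with hlt | hge
    · rcases Nat.lt_or_ge (k i) 1 with hlt' | hge'
      · have hi : k i = 0 := by omega
        have hw : ∀ e ∈ ({h : E × Bool | v h = i} : Finset _),
            M.halfWeight (τ e.1 e.2) (τ (flipHalf e).1 (flipHalf e).2) ≤
              if fl (flipHalf e) = false then ε else 1 := by
          intro e he
          have h1 : τ e.1 e.2 = false := hk0 i hi e (Finset.mem_filter.1 he).2
          rw [h1]
          simp only [hfl]
          cases τ (flipHalf e).1 (flipHalf e).2
          · simp only [SBM.halfWeight, if_true]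
            exact (Real.sqrt_le_left hε).2 hM.edge
          · simp [SBM.halfWeight]
        have hp1 : ∏ e : E × Bool with v e = i,
            M.halfWeight (τ e.1 e.2) (τ (flipHalf e).1 (flipHalf e).2) ≤ ε ^ m i := by
          refine (Finset.prod_le_prod (fun e _ => M.halfWeight_nonneg _ _) hw).trans ?_
          simp only [m, hi, if_true, hb0 i hi, add_zero]
          by_cases hiN : i ∈ N₀
          · have h2 := Finset.mem_filter.1 hiN
            have hmem : h i ∈ ({h : E × Bool | v h = i} : Finset _) := by
              simp [hv i h2.1]
            simp only [hiN, if_true, pow_one]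
            rw [← Finset.mul_prod_erase _ _ hmem, if_pos h2.2.2]
            refine mul_le_of_le_one_right hε (Finset.prod_le_one ?_ ?_)
            · intro e _; split_ifs <;> [exact hε; exact zero_le_one]
            · intro e _; split_ifs <;> [exact hM.le_one; exact le_rfl]
          · simp only [hiN, if_false, pow_zero]
            refine Finset.prod_le_one ?_ ?_
            · intro e _; split_ifs <;> [exact hε; exact zero_le_one]
            · intro e _; split_ifs <;> [exact hM.le_one; exact le_rfl]
        rw [hi]
        simpa [M.p_sum] using hp1
      · have hi : k i = 1 := by omega
        rw [hi, M.sum_p_mul_centred_pow_one, abs_zero, zero_mul]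
        positivity
    · have hm : m i = 1 + b i := by
        simp only [m]; rw [if_neg (by omega)]
      rw [hm]
      refine SBM.flagged_vertex_le hM hD v τ i hge ?_ ?_
      · refine Finset.card_le_card_of_injOn (fun u => flipHalf (h u)) ?_ ?_
        · intro u hu
          have hu1 := Finset.mem_filter.1 hu
          have hu2 := Finset.mem_filter.1 hu1.1
          simp only [Finset.coe_filter, Finset.mem_univ, true_and, Set.mem_ofPred_eq]
          refine ⟨hu1.2, hu2.2.2, ?_⟩
          rw [flipHalf_flipHalf]
          exact hk0 u hu2.2.1 _ (hv u hu2.1)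
        · intro u hu w hw heq
          have hu2 := Finset.mem_filter.1 (Finset.mem_filter.1 hu).1
          have hw2 := Finset.mem_filter.1 (Finset.mem_filter.1 hw).1
          have := congrArg flipHalf heq
          simp only [flipHalf_flipHalf] at this
          rw [← hv u hu2.1, this, hv w hw2.1]
      · refine (Finset.card_le_card ?_).trans (hfib i)
        exact Finset.filter_subset_filter _ (Finset.filter_subset _ _)
  have hksum : ∑ i, k i ≤ 2 * Fintype.card E := by
    have h1 : ∀ i, k i ≤ #{h : E × Bool | v h = i} := fun i =>
      Finset.card_le_card fun e he => by
        simp only [Finset.mem_filter, Finset.mem_univ, true_and] at he ⊢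
        exact he.1
    calc ∑ i, k i ≤ ∑ i, #{h : E × Bool | v h = i} := Finset.sum_le_sum fun i _ => h1 i
      _ = Fintype.card (E × Bool) :=
        (Finset.card_eq_sum_card_fiberwise (fun _ _ => Finset.mem_coe.2 (Finset.mem_univ _))).symm
      _ = 2 * Fintype.card E := by rw [Fintype.card_prod, Fintype.card_bool, mul_comm]
  have hmsum : #N ≤ ∑ i, m i := by
    have hb1 : ∑ i, b i = #N₁ :=
      (Finset.card_eq_sum_card_fiberwise (fun _ _ => Finset.mem_coe.2 (Finset.mem_univ _))).symm
    have h2 : #{u ∈ N | k u ≠ 0} + #N₀ ≤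
        ∑ i, (if k i = 0 then (if i ∈ N₀ then 1 else 0) else 1) := by
      have hd : Disjoint ({u ∈ N | k u ≠ 0} : Finset V) N₀ := by
        rw [Finset.disjoint_left]
        intro u hu hu'
        exact (Finset.mem_filter.1 hu).2 (Finset.mem_filter.1 hu').2.1
      rw [← Finset.card_union_of_disjoint hd, Finset.card_eq_sum_ones,
        ← Finset.sum_filter_add_sum_filter_not univ (fun i => i ∈ ({u ∈ N | k u ≠ 0} : Finset V) ∪ N₀)]
      refine le_add_right (le_of_eq ?_)
      rw [Finset.filter_mem_eq_inter, Finset.univ_inter]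
      refine Finset.sum_congr rfl fun i hi => ?_
      rcases Finset.mem_union.1 hi with hi | hi
      · rw [if_neg (Finset.mem_filter.1 hi).2]
      · rw [if_pos (Finset.mem_filter.1 hi).2.1, if_pos hi]
    have h3 : N = ({u ∈ N | k u ≠ 0} ∪ N₀) ∪ N₁ := by
      ext u
      simp only [N₀, N₁, Finset.mem_union, Finset.mem_filter]
      by_cases h0 : k u = 0 <;> cases fl (flipHalf (h u)) <;> simp [h0]
    calc #N = #(({u ∈ N | k u ≠ 0} ∪ N₀) ∪ N₁) := congrArg _ h3
      _ ≤ #{u ∈ N | k u ≠ 0} + #N₀ + #N₁ :=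
        (Finset.card_union_le _ _).trans (Nat.add_le_add_right (Finset.card_union_le _ _) _)
      _ ≤ ∑ i, m i := by
        simp only [m, Finset.sum_add_distrib, hb1]
        omega
  calc _ ≤ ∏ i, ((2 ^ (D + 1)) ^ k i * ε ^ m i) :=
        Finset.prod_le_prod (fun i _ => mul_nonneg (abs_nonneg _)
          (Finset.prod_nonneg fun h _ => M.halfWeight_nonneg _ _)) fun i _ => hvert i
    _ = (2 ^ (D + 1)) ^ (∑ i, k i) * ε ^ (∑ i, m i) := by
        rw [Finset.prod_mul_distrib, Finset.prod_pow_eq_pow_sum, Finset.prod_pow_eq_pow_sum]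
    _ ≤ _ := by
        gcongr ?_ * ?_
        · exact pow_le_pow_right₀ (one_le_pow₀ (by norm_num)) hksum
        · exact pow_le_pow_of_le_one hε hM.le_one hmsum


end

section
open Finset

theorem SBM.abs_fourier_le_one {k : ℕ} (M : SBM k) {V : Type*} [Fintype V] [DecidableEq V]
    (S : Finset (Sym2 V)) : |M.fourier S| ≤ 1 := by
  rw [← M.fourier_empty V]
  refine (Finset.abs_sum_le_sum_abs _ _).trans (Finset.sum_le_sum fun x _ => ?_)
  have h0 : 0 ≤ ∏ i, M.p (x i) := Finset.prod_nonneg fun i _ => M.p_nonneg _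
  rw [abs_mul, abs_of_nonneg h0, Finset.abs_prod, Finset.prod_empty]
  refine mul_le_mul_of_nonneg_left (Finset.prod_le_one (fun _ _ => abs_nonneg _) ?_) h0
  intro e _
  induction e using Sym2.ind with
  | _ i j => exact M.Q_abs_le _ _

/-- The Fourier coefficient of an edge set `S` is of order `ε ^ #N` for every set `N` of vertices
that can be assigned neighbours in `S` with no vertex being assigned more than `D` times. -/
theorem SBM.abs_fourier_le {M : SBM 2} {D : ℕ} {ε : ℝ} (hM : M.ScaleBound D ε) (hD : 2 ≤ D)
    {V : Type*} [Fintype V] [DecidableEq V] (S : Finset (Sym2 V)) (N : Finset V) (g : V → V)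
    (hg : ∀ u ∈ N, s(u, g u) ∈ S) (hfib : ∀ i, #{u ∈ N | g u = i} ≤ D) :
    |M.fourier S| ≤ (2 ^ (2 * D + 4)) ^ #S * ε ^ #N := by
  classical
  rcases N.eq_empty_or_nonempty with rfl | ⟨u₀, hu₀⟩
  · simpa using (M.abs_fourier_le_one S).trans
      (one_le_pow₀ (one_le_pow₀ (by norm_num : (1 : ℝ) ≤ 2)))
  have hout : ∀ e : Sym2 V, ∃ a : Bool → V, e = s(a false, a true) := by
    intro e
    induction e using Sym2.ind with
    | _ i j => exact ⟨fun s => bif s then j else i, rfl⟩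
  choose a ha using hout
  let v : S × Bool → V := fun h => a h.1 h.2
  have hhalf : ∀ u, ∃ h : S × Bool, u ∈ N → v h = u ∧ v (flipHalf h) = g u := by
    intro u
    by_cases hu : u ∈ N
    · have h1 := ha s(u, g u)
      rw [Sym2.eq_iff] at h1
      rcases h1 with h1 | h1
      · exact ⟨(⟨_, hg u hu⟩, false), fun _ => ⟨h1.1.symm, h1.2.symm⟩⟩
      · exact ⟨(⟨_, hg u hu⟩, true), fun _ => ⟨h1.1.symm, h1.2.symm⟩⟩
    · exact ⟨(⟨_, hg u₀ hu₀⟩, false), fun h => absurd h hu⟩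
  choose h hh using hhalf
  have hfib' : ∀ i, #{u ∈ N | v (flipHalf (h u)) = i} ≤ D := by
    intro i
    refine le_trans (le_of_eq ?_) (hfib i)
    refine congrArg _ (Finset.filter_congr fun u hu => ?_)
    rw [(hh u hu).2]
  have hmom : M.fourier S = ∑ x : V → Fin 2, (∏ i, M.p (x i)) *
      ∏ e : S, M.Q (x (v (e, false))) (x (v (e, true))) := by
    refine Finset.sum_congr rfl fun x _ => ?_
    rw [← Finset.prod_coe_sort S]
    congr 1
    refine Finset.prod_congr rfl fun e _ => ?_
    conv_lhs => rw [ha e, SBM.pairQ_mk]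
  rw [hmom, M.moment_eq_sum]
  calc _ ≤ ∑ τ : S → Bool → Bool, (2 ^ (D + 1)) ^ (2 * Fintype.card S) * ε ^ #N :=
        (Finset.abs_sum_le_sum_abs _ _).trans (Finset.sum_le_sum fun τ _ =>
          SBM.abs_term_le hM hD v N h (fun u hu => (hh u hu).1) hfib' τ)
    _ = (2 ^ (2 * D + 4)) ^ #S * ε ^ #N := by
        have h4 : (2 : ℝ) ^ (2 * D + 4) = 4 * (2 ^ (D + 1)) ^ 2 := by ring
        rw [Finset.sum_const, Finset.card_univ, Fintype.card_fun, Fintype.card_fun,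
          Fintype.card_bool, Fintype.card_coe, nsmul_eq_mul, h4, mul_pow]
        rw [Nat.cast_pow, pow_mul _ 2 #S, mul_assoc]
        norm_num

end

section
open Finset

/-! ### Low-degree tests force a large scale -/

/-- The nonempty edge sets with at most `D` edges. -/
def lowDegree (n D : ℕ) : Finset (Finset (Sym2 (Fin n))) :=
  {S ∈ (allPairs n).powerset | S ≠ ∅ ∧ #S ≤ D}

theorem IsPolynomialTest.mem_span {n D : ℕ} {f : SimpleGraph (Fin n) → ℝ}
    (hf : IsPolynomialTest D f) :
    f ∈ Submodule.span ℝ (signChar '' {S | S ⊆ allPairs n ∧ #S ≤ D}) := by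
  classical
  obtain ⟨P, hP, hfP⟩ := hf
  have hfe : f = ∑ d ∈ P.support, P.coeff d • fun G : SimpleGraph (Fin n) =>
      ∏ e ∈ d.support.map (Function.Embedding.subtype _),
        if e ∈ G.edgeSet then (1 : ℝ) else 0 := by
    funext G
    rw [hfP, MvPolynomial.eval_eq, Finset.sum_apply]
    refine Finset.sum_congr rfl fun d _ => ?_
    rw [Pi.smul_apply, smul_eq_mul, Finset.prod_map]
    congr 1
    refine Finset.prod_congr rfl fun e he => ?_
    simp only [Function.Embedding.subtype_apply]
    by_cases h : (e : Sym2 (Fin n)) ∈ G.edgeSet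
    · simp only [h, if_true, one_pow]
    · simp only [h, if_false, zero_pow (Finsupp.mem_support_iff.1 he)]
  rw [hfe]
  refine Submodule.sum_mem _ fun d hd => Submodule.smul_mem _ _ ?_
  set T := d.support.map (Function.Embedding.subtype _) with hT
  have hTD : #T ≤ D := by
    rw [hT, Finset.card_map]
    refine le_trans ?_ ((MvPolynomial.le_totalDegree hd).trans hP)
    rw [Finset.card_eq_sum_ones, Finsupp.sum]
    exact Finset.sum_le_sum fun e he =>
      Nat.one_le_iff_ne_zero.2 (Finsupp.mem_support_iff.1 he)
  have hTsub : T ⊆ allPairs n := by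
    intro e he
    obtain ⟨e', -, rfl⟩ := Finset.mem_map.1 he
    exact mem_allPairs.2 (SimpleGraph.not_isDiag_of_mem_edgeSet _ e'.2)
  -- Each edge indicator is the average of `1` and the signed indicator.
  have hexp : (fun G : SimpleGraph (Fin n) => ∏ e ∈ T, if e ∈ G.edgeSet then (1 : ℝ) else 0) =
      ∑ U ∈ T.powerset, ((1 / 2 : ℝ) ^ #T) • (signChar U : SimpleGraph (Fin n) → ℝ) := by
    funext G
    have h1 : ∀ e, (if e ∈ G.edgeSet then (1 : ℝ) else 0) =
        1 / 2 * (if e ∈ G.edgeSet then (1 : ℝ) else -1) + 1 / 2 := by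
      intro e; split_ifs <;> norm_num
    simp_rw [h1]
    rw [Finset.prod_add, Finset.sum_apply]
    refine Finset.sum_congr rfl fun U hU => ?_
    rw [Finset.prod_mul_distrib, Finset.prod_const, Finset.prod_const, Pi.smul_apply, smul_eq_mul,
      ← Finset.card_sdiff_add_card_eq_card (Finset.mem_powerset.1 hU), pow_add, signChar]
    ring
  rw [hexp]
  refine Submodule.sum_mem _ fun U hU => Submodule.smul_mem _ _ (Submodule.subset_span ?_)
  have hUT := Finset.mem_powerset.1 hU
  exact ⟨U, ⟨hUT.trans hTsub, (Finset.card_le_card hUT).trans hTD⟩, rfl⟩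

/-- The degree-`D` truncation of the likelihood ratio, without its constant term. -/
noncomputable def SBM.lowDegreeRatio {k : ℕ} (M : SBM k) (n D : ℕ) (G : SimpleGraph (Fin n)) : ℝ :=
  ∑ S ∈ lowDegree n D, M.fourier S * signChar S G

theorem graphMean_erdosRenyi_mul {n : ℕ} {S T : Finset (Sym2 (Fin n))} (hS : S ⊆ allPairs n)
    (hT : T ⊆ allPairs n) : graphMean (erdosRenyiLaw (1 / 2) n)
      (fun G => signChar S G * signChar T G) = if S = T then 1 else 0 := by
  simp_rw [signChar_mul_signChar]
  have := graphMean_erdosRenyi_signChar (symmDiff_subset_allPairs hS hT)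
  rw [show (signChar (symmDiff S T) : SimpleGraph (Fin n) → ℝ) =
    fun G => signChar (symmDiff S T) G from rfl] at this
  rw [this]
  have : symmDiff S T = ∅ ↔ S = T := symmDiff_eq_bot
  simp only [this]

theorem lowDegree_subset {n D : ℕ} {S : Finset (Sym2 (Fin n))} (h : S ∈ lowDegree n D) :
    S ⊆ allPairs n := Finset.mem_powerset.1 (Finset.mem_filter.1 h).1

/-- For a polynomial of degree at most `D`, the gap between its means is its correlation with the
truncated likelihood ratio. -/
theorem SBM.mean_sub_mean_eq {k : ℕ} (M : SBM k) {n D : ℕ} {f : SimpleGraph (Fin n) → ℝ}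
    (hf : IsPolynomialTest D f) :
    graphMean (M.law n) f - graphMean (erdosRenyiLaw (1 / 2) n) f =
      graphMean (erdosRenyiLaw (1 / 2) n) (fun G => f G * M.lowDegreeRatio n D G) := by
  have hspan := hf.mem_span
  clear hf
  induction hspan using Submodule.span_induction with
  | mem f h =>
    obtain ⟨U, ⟨hU, hUD⟩, rfl⟩ := h
    rw [graphMean_law_signChar M hU, graphMean_erdosRenyi_signChar hU]
    have h0 : (fun G => signChar U G * M.lowDegreeRatio n D G) = fun G =>
        ∑ S ∈ lowDegree n D, M.fourier S * (signChar U G * signChar S G) := by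
      funext G
      rw [SBM.lowDegreeRatio, Finset.mul_sum]
      exact Finset.sum_congr rfl fun S _ => mul_left_comm _ _ _
    rw [h0, graphMean_sum]
    simp only [graphMean_const_mul]
    have h1 : ∀ S ∈ lowDegree n D, M.fourier S * graphMean (erdosRenyiLaw (1 / 2) n)
        (fun G => signChar U G * signChar S G) = if U = S then M.fourier S else 0 := by
      intro S hS
      rw [graphMean_erdosRenyi_mul hU (lowDegree_subset hS), mul_ite, mul_one, mul_zero]
    rw [Finset.sum_congr rfl h1, Finset.sum_ite_eq]
    by_cases h0 : U = ∅
    · subst h0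
      simp [lowDegree, M.fourier_empty]
    · have : U ∈ lowDegree n D := by simp [lowDegree, hU, h0, hUD]
      simp [h0, this]
  | zero => simp [graphMean]
  | add f g _ _ hf hg =>
    simp only [Pi.add_apply, add_mul]
    rw [graphMean_add, ← hf, ← hg]
    have h1 : ∀ μ : SimpleGraph (Fin n) → ℝ, graphMean μ (f + g) = graphMean μ f + graphMean μ g :=
      fun μ => graphMean_add μ f g
    rw [h1, h1]
    ring
  | smul c f _ hf =>
    simp only [Pi.smul_apply, smul_eq_mul, mul_assoc]
    rw [graphMean_const_mul, ← hf]
    have h1 : ∀ μ : SimpleGraph (Fin n) → ℝ, graphMean μ (c • f) = c * graphMean μ f :=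
      fun μ => graphMean_const_mul μ f c
    rw [h1, h1]
    ring

theorem SBM.mean_lowDegreeRatio {k : ℕ} (M : SBM k) (n D : ℕ) :
    graphMean (erdosRenyiLaw (1 / 2) n) (M.lowDegreeRatio n D) = 0 := by
  have h := graphMean_sum (lowDegree n D) (erdosRenyiLaw (1 / 2) n)
    (fun S G => M.fourier S * signChar S G)
  refine h.trans (Finset.sum_eq_zero fun S hS => ?_)
  rw [graphMean_const_mul, graphMean_erdosRenyi_signChar (lowDegree_subset hS),
    if_neg (Finset.mem_filter.1 hS).2.1, mul_zero]

theorem SBM.mean_lowDegreeRatio_sq {k : ℕ} (M : SBM k) (n D : ℕ) :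
    graphMean (erdosRenyiLaw (1 / 2) n) (fun G => M.lowDegreeRatio n D G ^ 2) =
      ∑ S ∈ lowDegree n D, M.fourier S ^ 2 := by
  have h1 : ∀ G, M.lowDegreeRatio n D G ^ 2 = ∑ S ∈ lowDegree n D, ∑ T ∈ lowDegree n D,
      (M.fourier S * M.fourier T) * (signChar S G * signChar T G) := by
    intro G
    rw [sq, SBM.lowDegreeRatio, Finset.sum_mul_sum]
    exact Finset.sum_congr rfl fun S _ => Finset.sum_congr rfl fun T _ => by ring
  simp only [h1, graphMean_sum, graphMean_const_mul]
  refine Finset.sum_congr rfl fun S hS => ?_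
  have h2 : ∀ T ∈ lowDegree n D, M.fourier S * M.fourier T * graphMean (erdosRenyiLaw (1 / 2) n)
        (fun G => signChar S G * signChar T G) = if S = T then M.fourier S * M.fourier T else 0 := by
    intro T hT
    rw [graphMean_erdosRenyi_mul (lowDegree_subset hS) (lowDegree_subset hT), mul_ite, mul_one,
      mul_zero]
  rw [Finset.sum_congr rfl h2, Finset.sum_ite_eq, if_pos hS, sq]

/-- Cauchy–Schwarz: the squared gap between the means of a polynomial of degree at most `D` is at
most its null variance times the sum of the squared low-degree Fourier coefficients. -/
theorem SBM.sq_mean_sub_mean_le {k : ℕ} (M : SBM k) {n D : ℕ} {f : SimpleGraph (Fin n) → ℝ}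
    (hf : IsPolynomialTest D f) :
    (graphMean (M.law n) f - graphMean (erdosRenyiLaw (1 / 2) n) f) ^ 2 ≤
      graphVar (erdosRenyiLaw (1 / 2) n) f * ∑ S ∈ lowDegree n D, M.fourier S ^ 2 := by
  set m := graphMean (erdosRenyiLaw (1 / 2) n) f with hm
  have hcent : graphMean (M.law n) f - m = graphMean (erdosRenyiLaw (1 / 2) n)
      (fun G => (f G - m) * M.lowDegreeRatio n D G) := by
    have h1 : (fun G => (f G - m) * M.lowDegreeRatio n D G) = fun G =>
        f G * M.lowDegreeRatio n D G + (-m) * M.lowDegreeRatio n D G := by funext G; ring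
    have h2 : graphMean (erdosRenyiLaw (1 / 2) n) (fun G => M.lowDegreeRatio n D G) = 0 :=
      M.mean_lowDegreeRatio n D
    rw [h1, graphMean_add, graphMean_const_mul, h2, mul_zero, add_zero, hm]
    exact M.mean_sub_mean_eq hf
  rw [hcent, ← M.mean_lowDegreeRatio_sq, graphVar]
  refine Finset.sum_sq_le_sum_mul_sum_of_sq_le_mul _ (fun G _ => ?_) (fun G _ => ?_)
    (fun G _ => ?_)
  · exact mul_nonneg (erdosRenyiLaw_half_nonneg n G) (sq_nonneg _)
  · exact mul_nonneg (erdosRenyiLaw_half_nonneg n G) (sq_nonneg _)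
  · exact le_of_eq (by ring)

/-- The vertices touched by an edge set. -/
def touched {n : ℕ} (S : Finset (Sym2 (Fin n))) : Finset (Fin n) :=
  {u | ∃ e ∈ S, u ∈ e}

theorem SBM.abs_fourier_le_touched {M : SBM 2} {D : ℕ} {ε : ℝ} (hM : M.ScaleBound D ε)
    (hD : 2 ≤ D) {n : ℕ} {S : Finset (Sym2 (Fin n))} (hS : #S ≤ D) :
    |M.fourier S| ≤ (2 ^ (2 * D + 4)) ^ D * ε ^ #(touched S) := by
  have hex : ∀ u, ∃ w, u ∈ touched S → s(u, w) ∈ S := by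
    intro u
    by_cases hu : u ∈ touched S
    · obtain ⟨e, he, hue⟩ := (Finset.mem_filter.1 hu).2
      obtain ⟨w, rfl⟩ := hue
      exact ⟨w, fun _ => he⟩
    · exact ⟨u, fun h => absurd h hu⟩
  choose g hg using hex
  refine (SBM.abs_fourier_le hM hD S (touched S) g hg fun i => ?_).trans ?_
  · refine le_trans (Finset.card_le_card_of_injOn (fun u => s(u, i)) ?_ ?_) hS
    · intro u hu
      have h := Finset.mem_filter.1 hu
      have h2 := hg u h.1
      rw [h.2] at h2
      exact h2
    · intro u _ w _ h
      simp only [Sym2.eq_iff] at h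
      rcases h with h | h
      · exact h.1
      · exact h.1.trans h.2
  · have := hM.nonneg
    gcongr
    exact one_le_pow₀ (by norm_num)

theorem card_touched_le {n : ℕ} (S : Finset (Sym2 (Fin n))) : #(touched S) ≤ 2 * #S := by
  have h1 : touched S = S.biUnion fun e => e.toFinset := by
    ext u; simp [touched]
  rw [h1, mul_comm]
  refine Finset.card_biUnion_le_card_mul _ _ _ fun e _ => ?_
  rw [Sym2.card_toFinset]
  split_ifs <;> omega

theorem sum_pow_card_le {n m : ℕ} {δ L : ℝ} (hδ : 0 ≤ δ) (hL : 1 ≤ L) (h : n * δ ≤ L) :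
    ∑ N : Finset (Fin n) with #N ≤ m, δ ^ #N ≤ (m + 1) * L ^ m := by
  rw [Finset.sum_filter, ← Finset.powerset_univ]
  have h0 := Finset.sum_powerset_apply_card (fun v => if v ≤ m then δ ^ v else 0) (x :=
    (univ : Finset (Fin n)))
  rw [h0, Finset.card_univ, Fintype.card_fin]
  calc ∑ v ∈ range (n + 1), n.choose v • (if v ≤ m then δ ^ v else 0)
      ≤ ∑ v ∈ range (n + 1), if v ≤ m then L ^ m else 0 := by
        refine Finset.sum_le_sum fun v _ => ?_
        split_ifs with hv
        · rw [nsmul_eq_mul]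
          calc (n.choose v : ℝ) * δ ^ v ≤ (n : ℝ) ^ v * δ ^ v := by
                gcongr; exact_mod_cast Nat.choose_le_pow n v
            _ = (n * δ) ^ v := (mul_pow _ _ _).symm
            _ ≤ L ^ v := by gcongr
            _ ≤ L ^ m := pow_le_pow_right₀ hL hv
        · simp
    _ = #{v ∈ range (n + 1) | v ≤ m} * L ^ m := by
        rw [← Finset.sum_filter, Finset.sum_const, nsmul_eq_mul]
    _ ≤ (m + 1) * L ^ m := by
        gcongr
        have : #{v ∈ range (n + 1) | v ≤ m} ≤ #(range (m + 1)) :=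
          Finset.card_le_card fun v hv => by
            simp only [Finset.mem_filter, Finset.mem_range] at hv ⊢; omega
        rw [Finset.card_range] at this
        exact_mod_cast this

/-- If `n ε²` is bounded, then so is the low-degree chi-square divergence. -/
theorem SBM.sum_fourier_sq_le (D : ℕ) (hD : 2 ≤ D) (L : ℝ) : ∃ B : ℝ, ∀ (M : SBM 2) (ε : ℝ)
    (n : ℕ), M.ScaleBound D ε → n * ε ^ 2 ≤ L → ∑ S ∈ lowDegree n D, M.fourier S ^ 2 ≤ B := by
  refine ⟨((2 ^ (2 * D + 4)) ^ D) ^ 2 * (2 ^ ((2 * D + 1).choose 2) *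
    (((2 * D : ℕ) + 1) * (max 1 L) ^ (2 * D))), fun M ε n hM hL => ?_⟩
  have hδ : 0 ≤ ε ^ 2 := sq_nonneg _
  have hmaps : ∀ S ∈ lowDegree n D, touched S ∈ ({N | #N ≤ 2 * D} : Finset (Finset (Fin n))) := by
    intro S hS
    have h1 := (Finset.mem_filter.1 hS).2.2
    have h2 := card_touched_le S
    simp only [Finset.mem_filter, Finset.mem_univ, true_and]
    omega
  calc ∑ S ∈ lowDegree n D, M.fourier S ^ 2
      ≤ ∑ S ∈ lowDegree n D, ((2 ^ (2 * D + 4)) ^ D) ^ 2 * (ε ^ 2) ^ #(touched S) := by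
        refine Finset.sum_le_sum fun S hS => ?_
        rw [← sq_abs]
        calc |M.fourier S| ^ 2 ≤ ((2 ^ (2 * D + 4)) ^ D * ε ^ #(touched S)) ^ 2 := by
              gcongr
              exact SBM.abs_fourier_le_touched hM hD (Finset.mem_filter.1 hS).2.2
          _ = _ := by rw [mul_pow, ← pow_mul ε, ← pow_mul ε, mul_comm #(touched S)]
    _ = ((2 ^ (2 * D + 4)) ^ D) ^ 2 * ∑ N : Finset (Fin n) with #N ≤ 2 * D,
          ∑ S ∈ lowDegree n D with touched S = N, (ε ^ 2) ^ #(touched S) := by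
        rw [← Finset.mul_sum, Finset.sum_fiberwise_of_maps_to hmaps]
    _ ≤ ((2 ^ (2 * D + 4)) ^ D) ^ 2 * ∑ N : Finset (Fin n) with #N ≤ 2 * D,
          2 ^ ((2 * D + 1).choose 2) * (ε ^ 2) ^ #N := by
        gcongr with N hN
        have hcard : #{S ∈ lowDegree n D | touched S = N} ≤ 2 ^ ((2 * D + 1).choose 2) := by
          calc #{S ∈ lowDegree n D | touched S = N} ≤ #(N.sym2.powerset) := by
                refine Finset.card_le_card fun S hS => ?_
                have h1 := (Finset.mem_filter.1 hS).2
                rw [Finset.mem_powerset]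
                intro e he
                rw [Finset.mem_sym2_iff]
                intro u hu
                rw [← h1]
                exact Finset.mem_filter.2 ⟨Finset.mem_univ _, e, he, hu⟩
            _ = 2 ^ ((#N + 1).choose 2) := by rw [Finset.card_powerset, Finset.card_sym2]
            _ ≤ _ := by
                have := (Finset.mem_filter.1 hN).2
                exact Nat.pow_le_pow_right (by norm_num) (Nat.choose_le_choose 2 (by omega))
        calc ∑ S ∈ lowDegree n D with touched S = N, (ε ^ 2) ^ #(touched S)
            = #{S ∈ lowDegree n D | touched S = N} * (ε ^ 2) ^ #N := by
              rw [← nsmul_eq_mul, ← Finset.sum_const]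
              exact Finset.sum_congr rfl fun S hS => by rw [(Finset.mem_filter.1 hS).2]
          _ ≤ _ := by
              gcongr
              exact_mod_cast hcard
    _ ≤ _ := by
        rw [← Finset.mul_sum]
        gcongr
        exact sum_pow_card_le hδ (le_max_left _ _) (hL.trans (le_max_right _ _))

/-- If some low-degree polynomials distinguish the models, then the scale is `ω(n ^ (-1 / 2))`. -/
theorem tendsto_scale_of_distinguishes {D : ℕ} (hD : 2 ≤ D) {M : ℕ → SBM 2} {ε : ℕ → ℝ}
    (hM : ∀ n, (M n).ScaleBound D (ε n)) {f : (n : ℕ) → SimpleGraph (Fin n) → ℝ}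
    (hf : ∀ n, IsPolynomialTest D (f n))
    (h : Distinguishes (fun n => (M n).law n) (fun n => erdosRenyiLaw (1 / 2) n) f) :
    Filter.Tendsto (fun n : ℕ => n * ε n ^ 2) Filter.atTop Filter.atTop := by
  rw [Filter.tendsto_atTop]
  intro L
  obtain ⟨B, hB⟩ := SBM.sum_fourier_sq_le D hD L
  filter_upwards [h √B] with n hn
  by_contra! hlt
  have h1 := hB (M n) (ε n) n (hM n) hlt.le
  have h2 := (M n).sq_mean_sub_mean_le (hf n)
  set v := max (graphVar ((M n).law n) (f n)) (graphVar (erdosRenyiLaw (1 / 2) n) (f n)) with hv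
  have h3 : graphVar (erdosRenyiLaw (1 / 2) n) (f n) ≤ v := le_max_right _ _
  have h0 : 0 ≤ graphVar (erdosRenyiLaw (1 / 2) n) (f n) :=
    Finset.sum_nonneg fun G _ => mul_nonneg (erdosRenyiLaw_half_nonneg n G) (sq_nonneg _)
  have hΦ : 0 ≤ ∑ S ∈ lowDegree n D, (M n).fourier S ^ 2 :=
    Finset.sum_nonneg fun S _ => sq_nonneg _
  refine absurd hn (not_lt.2 ?_)
  rw [← Real.sqrt_mul (hΦ.trans h1)]
  refine Real.le_sqrt_of_sq_le ?_
  rw [sq_abs]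
  calc _ ≤ _ := h2
    _ ≤ v * B := mul_le_mul h3 h1 hΦ (h0.trans h3)
    _ = B * v := mul_comm _ _

end

section
open Finset

/-! ### Sums over embedded copies -/

/-- Averaging a function of finitely many distinct labels only involves those labels. -/
theorem SBM.sum_labels_comp {k : ℕ} (M : SBM k) {V W : Type*} [Fintype V] [DecidableEq V]
    [Fintype W] [DecidableEq W] (φ : V ↪ W) (F : (V → Fin k) → ℝ) :
    ∑ x : W → Fin k, (∏ w, M.p (x w)) * F (x ∘ φ) = ∑ y : V → Fin k, (∏ v, M.p (y v)) * F y := by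
  have h1 : ∀ x : W → Fin k, F (x ∘ φ) =
      ∑ y : V → Fin k, F y * ∏ w, ∏ v with φ v = w, if x w = y v then (1 : ℝ) else 0 := by
    intro x
    have h2 : ∀ y : V → Fin k, (∏ w, ∏ v with φ v = w, if x w = y v then (1 : ℝ) else 0) =
        if x ∘ φ = y then 1 else 0 := by
      intro y
      have h3 : ∀ w, (∏ v with φ v = w, if x w = y v then (1 : ℝ) else 0) =
          ∏ v with φ v = w, if x (φ v) = y v then (1 : ℝ) else 0 := fun w =>
        Finset.prod_congr rfl fun v hv => by rw [(Finset.mem_filter.1 hv).2]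
      simp_rw [h3]
      rw [Finset.prod_fiberwise, Finset.prod_ite_zero, Finset.prod_const_one]
      simp [funext_iff]
    simp [h2]
  simp_rw [h1, Finset.mul_sum]
  rw [Finset.sum_comm]
  refine Finset.sum_congr rfl fun y _ => ?_
  have h4 : ∀ x : W → Fin k, (∏ w, M.p (x w)) * (F y * ∏ w, ∏ v with φ v = w,
      if x w = y v then (1 : ℝ) else 0) = F y * ∏ w, (M.p (x w) * ∏ v with φ v = w,
      if x w = y v then (1 : ℝ) else 0) := by
    intro x; rw [Finset.prod_mul_distrib]; ring
  simp_rw [h4]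
  rw [← Finset.mul_sum, ← Fintype.prod_sum (fun w a => M.p a * ∏ v with φ v = w,
      if a = y v then (1 : ℝ) else 0), mul_comm]
  congr 1
  refine (Fintype.prod_of_injective φ φ.injective _ _ ?_ ?_).symm
  · intro w hw
    have h5 : ({v | φ v = w} : Finset V) = ∅ :=
      Finset.filter_eq_empty_iff.2 fun v _ h => hw ⟨v, h⟩
    simp [h5, M.p_sum]
  · intro v
    have h5 : ({v' | φ v' = φ v} : Finset V) = {v} := by ext; simp
    rw [h5]
    simp

/-- Edge set of the copy of `H` placed by the embedding `φ`. -/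
noncomputable def copyEdges {V : Type*} [Fintype V] (H : SimpleGraph V) [DecidableRel H.Adj]
    {W : Type*} (φ : V ↪ W) : Finset (Sym2 W) :=
  H.edgeFinset.map φ.sym2Map

section copies

variable {V : Type} [Fintype V] (H : SimpleGraph V) [DecidableRel H.Adj]

theorem pairQ_map {k : ℕ} (M : SBM k) {V W : Type*} (φ : V → W) (x : W → Fin k) (e : Sym2 V) :
    M.pairQ x (e.map φ) = M.pairQ (x ∘ φ) e := by
  induction e using Sym2.ind with
  | _ i j => rfl

theorem prod_copyEdges {k : ℕ} (M : SBM k) {W : Type*} (φ : V ↪ W) (x : W → Fin k) :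
    ∏ e ∈ copyEdges H φ, M.pairQ x e = ∏ e ∈ H.edgeFinset, M.pairQ (x ∘ φ) e := by
  rw [copyEdges, Finset.prod_map]
  exact Finset.prod_congr rfl fun e _ => pairQ_map M φ x e

theorem fourier_copyEdges [DecidableEq V] {k : ℕ} (M : SBM k) {W : Type*} [Fintype W]
    [DecidableEq W] (φ : V ↪ W) : M.fourier (copyEdges H φ) = M.fourier H.edgeFinset := by
  simp only [SBM.fourier, prod_copyEdges]
  exact M.sum_labels_comp φ (fun y => ∏ e ∈ H.edgeFinset, M.pairQ y e)

theorem mem_copyEdges {W : Type*} {φ : V ↪ W} {a b : V} :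
    s(φ a, φ b) ∈ copyEdges H φ ↔ H.Adj a b := by
  have : s(φ a, φ b) = φ.sym2Map s(a, b) := rfl
  rw [copyEdges, this, Finset.mem_map', SimpleGraph.mem_edgeFinset, SimpleGraph.mem_edgeSet]

theorem mem_range_of_mem_copyEdges {W : Type*} {φ : V ↪ W} {e : Sym2 W}
    (he : e ∈ copyEdges H φ) {u : W} (hu : u ∈ e) : ∃ a, φ a = u := by
  obtain ⟨e', -, rfl⟩ := Finset.mem_map.1 he
  obtain ⟨a, -, rfl⟩ := Sym2.mem_map.1 hu
  exact ⟨a, rfl⟩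

theorem copyEdges_subset {n : ℕ} (φ : V ↪ Fin n) : copyEdges H φ ⊆ allPairs n := by
  intro e he
  obtain ⟨e', he', rfl⟩ := Finset.mem_map.1 he
  rw [mem_allPairs]
  have h1 := SimpleGraph.not_isDiag_of_mem_edgeSet _ (SimpleGraph.mem_edgeFinset.1 he')
  induction e' using Sym2.ind with
  | _ i j =>
    intro h
    exact h1 (by simpa using φ.injective (by simpa using h))

/-- Number of vertices shared by two embedded copies. -/
def overlap {V W : Type*} [Fintype V] [DecidableEq W] (φ ψ : V ↪ W) : ℕ :=
  #(univ.map φ ∩ univ.map ψ)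

theorem overlap_eq_card {V W : Type*} [Fintype V] [DecidableEq W] (φ ψ : V ↪ W) :
    overlap φ ψ = #{w | ψ w ∈ univ.map φ} := by
  rw [overlap, ← Finset.card_map ψ]
  congr 1
  ext u
  simp only [Finset.mem_inter, Finset.mem_map, Finset.mem_filter, Finset.mem_univ, true_and]
  constructor
  · rintro ⟨⟨a, rfl⟩, b, hb⟩
    exact ⟨b, ⟨a, hb.symm⟩, hb⟩
  · rintro ⟨b, ⟨a, ha⟩, rfl⟩
    exact ⟨⟨a, ha⟩, b, rfl⟩

/-- Vertex-disjoint copies have independent characters. -/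
theorem fourier_symmDiff_of_overlap_eq_zero [DecidableEq V] {k : ℕ} (M : SBM k)
    {W : Type*} [Fintype W] [DecidableEq W] {φ ψ : V ↪ W} (h : overlap φ ψ = 0) :
    M.fourier (symmDiff (copyEdges H φ) (copyEdges H ψ)) =
      M.fourier (copyEdges H φ) * M.fourier (copyEdges H ψ) := by
  have hdisj : ∀ a b, φ a ≠ ψ b := by
    intro a b hab
    rw [overlap, Finset.card_eq_zero] at h
    have : φ a ∈ univ.map φ ∩ univ.map ψ := by
      rw [Finset.mem_inter]
      exact ⟨Finset.mem_map_of_mem φ (Finset.mem_univ a),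
        hab ▸ Finset.mem_map_of_mem ψ (Finset.mem_univ b)⟩
    rw [h] at this
    exact absurd this (Finset.notMem_empty _)
  have hd : Disjoint (copyEdges H φ) (copyEdges H ψ) := by
    rw [Finset.disjoint_left]
    intro e he he'
    induction e using Sym2.ind with
    | _ i j =>
      obtain ⟨a, ha⟩ := mem_range_of_mem_copyEdges H he (Sym2.mem_mk_left i j)
      obtain ⟨b, hb⟩ := mem_range_of_mem_copyEdges H he' (Sym2.mem_mk_left i j)
      exact hdisj a b (ha.trans hb.symm)
  let θ : V ⊕ V ↪ W := ⟨Sum.elim φ ψ, φ.injective.sumElim ψ.injective hdisj⟩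
  let F : (V ⊕ V → Fin k) → ℝ := fun y => (∏ e ∈ H.edgeFinset, M.pairQ (y ∘ Sum.inl) e) *
    ∏ e ∈ H.edgeFinset, M.pairQ (y ∘ Sum.inr) e
  have h1 : M.fourier (symmDiff (copyEdges H φ) (copyEdges H ψ)) =
      ∑ x : W → Fin k, (∏ i, M.p (x i)) * F (x ∘ θ) := by
    rw [hd.symmDiff_eq_sup, Finset.sup_eq_union, SBM.fourier]
    refine Finset.sum_congr rfl fun x _ => ?_
    rw [Finset.prod_union hd, prod_copyEdges, prod_copyEdges]
    rfl
  refine h1.trans ((M.sum_labels_comp θ F).trans ?_)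
  rw [fourier_copyEdges, fourier_copyEdges, SBM.fourier,
    Finset.sum_mul_sum, ← Fintype.sum_prod_type', ← Equiv.sum_comp
    (Equiv.sumArrowEquivProdArrow V V (Fin k)).symm]
  refine Finset.sum_congr rfl fun y _ => ?_
  rw [Fintype.prod_sum_type]
  simp only [Equiv.sumArrowEquivProdArrow, Equiv.coe_fn_symm_mk, Sum.elim_inl, Sum.elim_inr]
  have e1 : (Sum.elim y.1 y.2) ∘ Sum.inl = y.1 := rfl
  have e2 : (Sum.elim y.1 y.2) ∘ Sum.inr = y.2 := rfl
  simp only [F, e1, e2]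
  ring

/-- The sum of the characters of all embedded copies of `H`: the signed count of `H`, up to the
number of automorphisms. -/
noncomputable def embCount [DecidableEq V] {n : ℕ} (G : SimpleGraph (Fin n)) : ℝ :=
  ∑ φ : V ↪ Fin n, signChar (copyEdges H φ) G

theorem exists_perm_trans {W : Type*} [Fintype W] [DecidableEq W] (φ ψ : V ↪ W) :
    ∃ σ : Equiv.Perm W, φ.trans σ.toEmbedding = ψ := by
  classical
  let e : {x // x ∈ Set.range φ} ≃ {x // x ∈ Set.range ψ} :=
    (Equiv.ofInjective φ φ.injective).symm.trans (Equiv.ofInjective ψ ψ.injective)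
  refine ⟨e.extendSubtype, ?_⟩
  ext v
  have h := Equiv.extendSubtype_apply_of_mem e (φ v) ⟨v, rfl⟩
  simp only [Function.Embedding.trans_apply, Equiv.coe_toEmbedding]
  rw [h]
  simp [e]

theorem exists_embCount_eq [DecidableEq V] (n : ℕ) : ∃ A : ℝ, 0 < A ∧
    ∀ G : SimpleGraph (Fin n), embCount H G = A * signedCount H G := by
  classical
  rcases isEmpty_or_nonempty (V ↪ Fin n) with hE | ⟨⟨φ₀⟩⟩
  · exact ⟨1, one_pos, fun G => by simp [embCount, signedCount]⟩
  have hcard : ∀ φ : V ↪ Fin n, #{ψ : V ↪ Fin n | H.map ψ = H.map φ} =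
      #{ψ : V ↪ Fin n | H.map ψ = H.map φ₀} := by
    suffices h : ∀ φ φ' : V ↪ Fin n, #{ψ : V ↪ Fin n | H.map ψ = H.map φ} ≤
        #{ψ : V ↪ Fin n | H.map ψ = H.map φ'} from fun φ => le_antisymm (h _ _) (h _ _)
    intro φ φ'
    obtain ⟨σ, rfl⟩ := exists_perm_trans φ φ'
    refine Finset.card_le_card_of_injOn (fun ψ => ψ.trans σ.toEmbedding) ?_ ?_
    · intro ψ hψ
      have h1 : H.map ψ = H.map φ := by simpa using hψ
      have h2 : ∀ θ : V ↪ Fin n, H.map (θ.trans σ.toEmbedding) = (H.map θ).map σ := by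
        intro θ
        rw [SimpleGraph.map_map]
        rfl
      simp only [Finset.coe_filter, Finset.mem_univ, true_and, Set.mem_ofPred_eq]
      rw [h2, h2, h1]
    · intro ψ _ ψ' _ h
      ext v
      have := DFunLike.congr_fun h v
      simp only [Function.Embedding.trans_apply, Equiv.coe_toEmbedding] at this
      rw [σ.injective this]
  refine ⟨#{ψ : V ↪ Fin n | H.map ψ = H.map φ₀}, ?_, fun G => ?_⟩
  · exact_mod_cast Finset.card_pos.2 ⟨φ₀, by simp⟩
  · have h1 : ∀ φ : V ↪ Fin n, signChar (copyEdges H φ) G =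
        (fun K : SimpleGraph (Fin n) =>
          ∏ e ∈ K.edgeFinset, if e ∈ G.edgeSet then (1 : ℝ) else -1) (H.map φ) := by
      intro φ
      have h2 : copyEdges H φ = (H.map φ).edgeFinset := by
        ext e
        rw [SimpleGraph.mem_edgeFinset, SimpleGraph.edgeSet_map, copyEdges, Finset.mem_map]
        simp only [SimpleGraph.mem_edgeFinset, Set.mem_image]
      rw [signChar, h2]
      exact Finset.prod_congr (by congr!) fun e _ => by congr
    simp only [embCount, h1]
    rw [Finset.sum_comp (fun K : SimpleGraph (Fin n) =>
      ∏ e ∈ K.edgeFinset, if e ∈ G.edgeSet then (1 : ℝ) else -1) (fun φ : V ↪ Fin n => H.map φ),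
      signedCount, Finset.mul_sum]
    refine Finset.sum_congr (by congr!) fun K hK => ?_
    obtain ⟨φ, -, rfl⟩ := Finset.mem_image.1 hK
    rw [hcard φ, nsmul_eq_mul]

theorem graphMean_embCount [DecidableEq V] {n : ℕ} (μ : SimpleGraph (Fin n) → ℝ) :
    graphMean μ (embCount H) = ∑ φ : V ↪ Fin n, graphMean μ (signChar (copyEdges H φ)) :=
  graphMean_sum _ μ _

theorem graphVar_embCount [DecidableEq V] {n : ℕ} {μ : SimpleGraph (Fin n) → ℝ} (hμ : ∑ G, μ G = 1) :
    graphVar μ (embCount H) = ∑ φ : V ↪ Fin n, ∑ ψ : V ↪ Fin n,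
      (graphMean μ (signChar (symmDiff (copyEdges H φ) (copyEdges H ψ))) -
        graphMean μ (signChar (copyEdges H φ)) * graphMean μ (signChar (copyEdges H ψ))) := by
  rw [graphVar_eq hμ, graphMean_embCount, sq, Finset.sum_mul_sum]
  simp only [Finset.sum_sub_distrib]
  congr 1
  have h1 : (fun G => embCount H G * embCount H G) = fun G => ∑ φ : V ↪ Fin n, ∑ ψ : V ↪ Fin n,
      signChar (symmDiff (copyEdges H φ) (copyEdges H ψ)) G := by
    funext G
    rw [embCount, Finset.sum_mul_sum]
    simp_rw [signChar_mul_signChar]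
  rw [h1, graphMean_sum]
  refine Finset.sum_congr rfl fun φ _ => ?_
  rw [graphMean_sum]

/-- The embeddings meeting a given one, weighted by `x` to the size of the overlap. -/
theorem sum_overlap_pow_le [DecidableEq V] {n : ℕ} (φ : V ↪ Fin n) {x : ℝ} (hx : 0 ≤ x) :
    ∑ ψ : V ↪ Fin n, (if overlap φ ψ = 0 then 0 else x ^ overlap φ ψ) ≤
      (n + Fintype.card V * x) ^ Fintype.card V - (n : ℝ) ^ Fintype.card V := by
  let R : Finset (Fin n) := univ.map φ
  have hprod : ∀ f : V → Fin n, ∏ w, (1 + if f w ∈ R then x else 0) = (1 + x) ^ #{w | f w ∈ R} := by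
    intro f
    have : ∀ w, (1 + if f w ∈ R then x else 0) = if f w ∈ R then 1 + x else 1 := by
      intro w; split_ifs <;> simp
    simp_rw [this]
    rw [Finset.prod_ite, Finset.prod_const, Finset.prod_const_one, mul_one]
  have hnn : ∀ f : V → Fin n, 0 ≤ ∏ w, (1 + if f w ∈ R then x else 0) - 1 := by
    intro f
    rw [hprod, sub_nonneg]
    exact one_le_pow₀ (by linarith)
  calc ∑ ψ : V ↪ Fin n, (if overlap φ ψ = 0 then 0 else x ^ overlap φ ψ)
      ≤ ∑ ψ : V ↪ Fin n, (∏ w, (1 + if ψ w ∈ R then x else 0) - 1) := by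
        refine Finset.sum_le_sum fun ψ _ => ?_
        split_ifs with h
        · exact hnn ψ
        · rw [hprod, ← overlap_eq_card]
          have := pow_add_pow_le zero_le_one hx h
          rw [one_pow] at this
          linarith
    _ = ∑ f ∈ (univ : Finset (V ↪ Fin n)).map ⟨fun ψ : V ↪ Fin n => (ψ : V → Fin n),
          DFunLike.coe_injective⟩,
          (∏ w, (1 + if f w ∈ R then x else 0) - 1) := by
        rw [Finset.sum_map]; rfl
    _ ≤ ∑ f : V → Fin n, (∏ w, (1 + if f w ∈ R then x else 0) - 1) :=
        Finset.sum_le_sum_of_subset_of_nonneg (Finset.subset_univ _) fun f _ _ => hnn f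
    _ = _ := by
        have hR : ∑ a, (1 + if a ∈ R then x else 0) = n + Fintype.card V * x := by
          rw [Finset.sum_add_distrib, Finset.sum_ite_mem]
          simp [R, Finset.card_univ]
        rw [Finset.sum_sub_distrib, ← Fintype.prod_sum (fun (_ : V) a => 1 + if a ∈ R then x else 0)]
        simp [hR, Finset.card_univ]

end copies
end

section
open Finset

/-! ### Variance of the signed count of a graph of maximal scale -/

section variance

variable {V : Type} [Fintype V] (H : SimpleGraph V) [DecidableRel H.Adj] [DecidableEq V]

/-- Two copies sharing `r` vertices contribute to the variance at most `ε ^ (2 v)` times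
`ε ^ (-2 r) + η n ^ r`, up to the constant `K`. Since about a fraction `n ^ (-r)` of all pairs shares
`r` vertices, this makes overlapping pairs negligible once `n ε²` is large and `η` is small. -/
def SBM.OverlapBound (M : SBM 2) (n : ℕ) (ε K η : ℝ) : Prop :=
  ∀ φ ψ : V ↪ Fin n, overlap φ ψ ≠ 0 →
    |M.fourier (symmDiff (copyEdges H φ) (copyEdges H ψ))| ≤
      K * ε ^ (2 * Fintype.card V) * ((ε ^ 2)⁻¹ ^ overlap φ ψ + η * n ^ overlap φ ψ)

theorem graphVar_embCount_le {n : ℕ} {μ : SimpleGraph (Fin n) → ℝ} (hμ : ∑ G, μ G = 1)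
    {ε K η : ℝ} (hK : 0 ≤ K) (hε : 0 ≤ ε) (hη : 0 ≤ η)
    (h : ∀ φ ψ : V ↪ Fin n,
      graphMean μ (signChar (symmDiff (copyEdges H φ) (copyEdges H ψ))) -
        graphMean μ (signChar (copyEdges H φ)) * graphMean μ (signChar (copyEdges H ψ)) ≤
      if overlap φ ψ = 0 then 0 else
        K * ε ^ (2 * Fintype.card V) * ((ε ^ 2)⁻¹ ^ overlap φ ψ + η * n ^ overlap φ ψ)) :
    graphVar μ (embCount H) ≤ K * ε ^ (2 * Fintype.card V) * (n ^ Fintype.card V *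
      (((n + Fintype.card V * (ε ^ 2)⁻¹) ^ Fintype.card V - (n : ℝ) ^ Fintype.card V) +
        η * (n + Fintype.card V * n) ^ Fintype.card V)) := by
  rw [graphVar_embCount H hμ]
  set v := Fintype.card V with hv
  have hx : 0 ≤ (ε ^ 2)⁻¹ := by positivity
  have hinner : ∀ φ : V ↪ Fin n, ∑ ψ : V ↪ Fin n,
      (graphMean μ (signChar (symmDiff (copyEdges H φ) (copyEdges H ψ))) -
        graphMean μ (signChar (copyEdges H φ)) * graphMean μ (signChar (copyEdges H ψ))) ≤
      K * ε ^ (2 * v) * (((n + v * (ε ^ 2)⁻¹) ^ v - (n : ℝ) ^ v) + η * (n + v * n) ^ v) := by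
    intro φ
    calc _ ≤ ∑ ψ : V ↪ Fin n, (K * ε ^ (2 * v) *
          ((if overlap φ ψ = 0 then 0 else (ε ^ 2)⁻¹ ^ overlap φ ψ) +
            η * (if overlap φ ψ = 0 then 0 else (n : ℝ) ^ overlap φ ψ))) := by
          refine Finset.sum_le_sum fun ψ _ => (h φ ψ).trans (le_of_eq ?_)
          split_ifs <;> simp
      _ = K * ε ^ (2 * v) * (∑ ψ : V ↪ Fin n, (if overlap φ ψ = 0 then 0 else
            (ε ^ 2)⁻¹ ^ overlap φ ψ) + η * ∑ ψ : V ↪ Fin n,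
            (if overlap φ ψ = 0 then 0 else (n : ℝ) ^ overlap φ ψ)) := by
          rw [← Finset.mul_sum, Finset.sum_add_distrib, ← Finset.mul_sum]
      _ ≤ _ := by
          have hn : (0 : ℝ) ≤ (n : ℝ) ^ v := by positivity
          gcongr
          · exact sum_overlap_pow_le φ hx
          · exact (sum_overlap_pow_le φ (Nat.cast_nonneg n)).trans (by linarith)
  refine (Finset.sum_le_sum fun φ _ => hinner φ).trans ?_
  have hnonneg : 0 ≤ ((n + v * (ε ^ 2)⁻¹) ^ v - (n : ℝ) ^ v) + η * (n + v * n) ^ v := by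
    have h1 : (n : ℝ) ^ v ≤ (n + v * (ε ^ 2)⁻¹) ^ v := by
      gcongr
      have : 0 ≤ (v : ℝ) * (ε ^ 2)⁻¹ := by positivity
      linarith
    have h2 : 0 ≤ η * ((n : ℝ) + v * n) ^ v := by positivity
    linarith
  have hcard : (Fintype.card (V ↪ Fin n) : ℝ) ≤ (n : ℝ) ^ v := by
    rw [Fintype.card_embedding_eq, Fintype.card_fin]
    exact_mod_cast Nat.descFactorial_le_pow n v
  rw [Finset.sum_const, Finset.card_univ, nsmul_eq_mul]
  calc _ ≤ (n : ℝ) ^ v * (K * ε ^ (2 * v) *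
        (((n + v * (ε ^ 2)⁻¹) ^ v - (n : ℝ) ^ v) + η * (n + v * n) ^ v)) := by gcongr
    _ = _ := by ring

theorem SBM.OverlapBound.graphVar_law_le {M : SBM 2} {n : ℕ} {ε K η : ℝ}
    (h : M.OverlapBound H n ε K η) (hK : 0 ≤ K) (hε : 0 ≤ ε) (hη : 0 ≤ η) :
    graphVar (M.law n) (embCount H) ≤ K * ε ^ (2 * Fintype.card V) * (n ^ Fintype.card V *
      (((n + Fintype.card V * (ε ^ 2)⁻¹) ^ Fintype.card V - (n : ℝ) ^ Fintype.card V) +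
        η * (n + Fintype.card V * n) ^ Fintype.card V)) := by
  refine graphVar_embCount_le H (sum_law M n) hK hε hη fun φ ψ => ?_
  rw [graphMean_law_signChar M (copyEdges_subset H φ),
    graphMean_law_signChar M (copyEdges_subset H ψ), graphMean_law_signChar M
    (symmDiff_subset_allPairs (copyEdges_subset H φ) (copyEdges_subset H ψ))]
  split_ifs with h0
  · rw [fourier_symmDiff_of_overlap_eq_zero H M h0, sub_self]
  · refine le_trans ?_ ((le_abs_self _).trans (h φ ψ h0))
    rw [fourier_copyEdges, fourier_copyEdges]
    exact sub_le_self _ (mul_self_nonneg _)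

omit [DecidableEq V] in
theorem overlap_eq_card_of_copyEdges_eq (hH : ∀ a, ∃ b, H.Adj a b) {n : ℕ} {φ ψ : V ↪ Fin n}
    (h : copyEdges H φ = copyEdges H ψ) : overlap φ ψ = Fintype.card V := by
  rw [overlap_eq_card, ← Finset.card_univ]
  congr 1
  refine Finset.filter_true_of_mem fun w _ => ?_
  obtain ⟨b, hb⟩ := hH w
  have h1 := (mem_copyEdges H (φ := ψ)).2 hb
  rw [← h] at h1
  obtain ⟨a, ha⟩ := mem_range_of_mem_copyEdges H h1 (Sym2.mem_mk_left _ _)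
  rw [← ha]
  exact Finset.mem_map_of_mem φ (Finset.mem_univ a)

theorem graphVar_erdosRenyi_embCount_le [Nonempty V] (hH : ∀ a, ∃ b, H.Adj a b) {n : ℕ}
    {ε K η : ℝ} (hK : 1 ≤ K) (hε : 0 < ε) (hη : 0 ≤ η) :
    graphVar (erdosRenyiLaw (1 / 2) n) (embCount H) ≤
      K * ε ^ (2 * Fintype.card V) * (n ^ Fintype.card V *
      (((n + Fintype.card V * (ε ^ 2)⁻¹) ^ Fintype.card V - (n : ℝ) ^ Fintype.card V) +
        η * (n + Fintype.card V * n) ^ Fintype.card V)) := by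
  have hK0 : 0 ≤ K := zero_le_one.trans hK
  refine graphVar_embCount_le H (sum_erdosRenyiLaw_half n) hK0 hε.le hη fun φ ψ => ?_
  have hprod : 0 ≤ graphMean (erdosRenyiLaw (1 / 2) n) (signChar (copyEdges H φ)) *
      graphMean (erdosRenyiLaw (1 / 2) n) (signChar (copyEdges H ψ)) := by
    rw [graphMean_erdosRenyi_signChar (copyEdges_subset H φ),
      graphMean_erdosRenyi_signChar (copyEdges_subset H ψ)]
    split_ifs <;> norm_num
  refine (sub_le_self _ hprod).trans ?_
  rw [graphMean_erdosRenyi_signChar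
    (symmDiff_subset_allPairs (copyEdges_subset H φ) (copyEdges_subset H ψ))]
  by_cases h0 : symmDiff (copyEdges H φ) (copyEdges H ψ) = ∅
  · have h1 := overlap_eq_card_of_copyEdges_eq H hH (symmDiff_eq_bot.1 h0)
    have h2 : Fintype.card V ≠ 0 := Fintype.card_ne_zero
    rw [if_pos h0, h1, if_neg h2]
    have h3 : ε ^ (2 * Fintype.card V) * (ε ^ 2)⁻¹ ^ Fintype.card V = 1 := by
      rw [pow_mul, ← mul_pow, mul_inv_cancel₀ (by positivity), one_pow]
    calc (1 : ℝ) ≤ K := hK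
      _ = K * (ε ^ (2 * Fintype.card V) * (ε ^ 2)⁻¹ ^ Fintype.card V) := by rw [h3, mul_one]
      _ = K * ε ^ (2 * Fintype.card V) * ((ε ^ 2)⁻¹ ^ Fintype.card V + 0) := by ring
      _ ≤ _ := by
        gcongr
        positivity
  · rw [if_neg h0]
    split_ifs
    · exact le_rfl
    · positivity

omit [DecidableEq V] in
/-- Edges at vertices belonging to exactly one of two copies lie in the symmetric difference of the
copies. If every vertex has a neighbour `nb w` in its own copy and no vertex is chosen too often by
these vertices, then the Fourier coefficient of the symmetric difference has the expected order. -/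
theorem SBM.abs_fourier_symmDiff_le {M : SBM 2} {D : ℕ} {ε : ℝ} (hM : M.ScaleBound D ε)
    (hD : 2 ≤ D) (hε : 0 < ε) {n : ℕ} (φ ψ : V ↪ Fin n) (nbφ nbψ : V → V)
    (hφ : ∀ w, H.Adj w (nbφ w)) (hψ : ∀ w, H.Adj w (nbψ w))
    (hfib : ∀ i, #{w | φ (nbφ w) = i ∧ φ w ∉ univ.map ψ} +
      #{w | ψ (nbψ w) = i ∧ ψ w ∉ univ.map φ} ≤ D) :
    |M.fourier (symmDiff (copyEdges H φ) (copyEdges H ψ))| ≤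
      (2 ^ (2 * D + 4)) ^ (2 * #H.edgeFinset) * ε ^ (2 * Fintype.card V) *
        (ε ^ 2)⁻¹ ^ overlap φ ψ := by
  classical
  set A : Finset (Fin n) := univ.map φ with hA
  set B : Finset (Fin n) := univ.map ψ with hB
  have hex : ∀ u, ∃ i, (∀ a, φ a = u → u ∉ B → i = φ (nbφ a)) ∧
      (∀ b, ψ b = u → u ∉ A → i = ψ (nbψ b)) := by
    intro u
    by_cases huA : u ∈ A
    · obtain ⟨a, -, rfl⟩ := Finset.mem_map.1 huA
      refine ⟨φ (nbφ a), fun a' ha' _ => ?_, fun b _ h => absurd huA h⟩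
      rw [φ.injective ha']
    · by_cases huB : u ∈ B
      · obtain ⟨b, -, rfl⟩ := Finset.mem_map.1 huB
        refine ⟨ψ (nbψ b), fun a _ h => absurd huB h, fun b' hb' _ => ?_⟩
        rw [ψ.injective hb']
      · refine ⟨u, fun a ha _ => ?_, fun b hb _ => ?_⟩
        · exact absurd (ha ▸ Finset.mem_map_of_mem φ (Finset.mem_univ a)) huA
        · exact absurd (hb ▸ Finset.mem_map_of_mem ψ (Finset.mem_univ b)) huB
  choose g hg1 hg2 using hex
  have hcover : ∀ u ∈ symmDiff A B, s(u, g u) ∈ symmDiff (copyEdges H φ) (copyEdges H ψ) := by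
    intro u hu
    rw [Finset.mem_symmDiff] at hu ⊢
    rcases hu with ⟨huA, huB⟩ | ⟨huB, huA⟩
    · left
      obtain ⟨a, -, rfl⟩ := Finset.mem_map.1 huA
      rw [hg1 _ a rfl huB]
      refine ⟨(mem_copyEdges H).2 (hφ a), fun h => huB ?_⟩
      obtain ⟨b, hb⟩ := mem_range_of_mem_copyEdges H h (Sym2.mem_mk_left _ _)
      exact hb ▸ Finset.mem_map_of_mem ψ (Finset.mem_univ b)
    · right
      obtain ⟨b, -, rfl⟩ := Finset.mem_map.1 huB
      rw [hg2 _ b rfl huA]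
      refine ⟨(mem_copyEdges H).2 (hψ b), fun h => huA ?_⟩
      obtain ⟨a, ha⟩ := mem_range_of_mem_copyEdges H h (Sym2.mem_mk_left _ _)
      exact ha ▸ Finset.mem_map_of_mem φ (Finset.mem_univ a)
  have hfib' : ∀ i, #{u ∈ symmDiff A B | g u = i} ≤ D := by
    intro i
    refine le_trans ?_ (hfib i)
    rw [← Finset.card_map φ, ← Finset.card_map ψ (s := {w | ψ (nbψ w) = i ∧ ψ w ∉ A})]
    refine le_trans (Finset.card_le_card ?_) (Finset.card_union_le _ _)
    intro u hu
    obtain ⟨hu, hui⟩ := Finset.mem_filter.1 hu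
    rw [Finset.mem_union]
    rcases Finset.mem_symmDiff.1 hu with ⟨huA, huB⟩ | ⟨huB, huA⟩
    · left
      obtain ⟨a, -, rfl⟩ := Finset.mem_map.1 huA
      refine Finset.mem_map_of_mem φ (Finset.mem_filter.2 ⟨Finset.mem_univ _, ?_, huB⟩)
      rw [← hui, hg1 _ a rfl huB]
    · right
      obtain ⟨b, -, rfl⟩ := Finset.mem_map.1 huB
      refine Finset.mem_map_of_mem ψ (Finset.mem_filter.2 ⟨Finset.mem_univ _, ?_, huA⟩)
      rw [← hui, hg2 _ b rfl huA]
  have hcardS : #(symmDiff (copyEdges H φ) (copyEdges H ψ)) ≤ 2 * #H.edgeFinset := by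
    rw [symmDiff_def, Finset.sup_eq_union, two_mul]
    refine (Finset.card_union_le _ _).trans (Nat.add_le_add ?_ ?_) <;>
      refine (Finset.card_le_card Finset.sdiff_subset).trans ?_ <;>
      rw [copyEdges, Finset.card_map]
  have hcardN : #(symmDiff A B) + 2 * overlap φ ψ = 2 * Fintype.card V := by
    have h1 : #A = Fintype.card V := by rw [hA, Finset.card_map, Finset.card_univ]
    have h2 : #B = Fintype.card V := by rw [hB, Finset.card_map, Finset.card_univ]
    have h3 := Finset.card_sdiff_add_card_inter A B
    have h4 := Finset.card_sdiff_add_card_inter B A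
    rw [Finset.inter_comm B A] at h4
    rw [symmDiff_def, Finset.sup_eq_union, Finset.card_union_of_disjoint disjoint_sdiff_sdiff]
    have h5 : overlap φ ψ = #(A ∩ B) := rfl
    omega
  refine (SBM.abs_fourier_le hM hD _ _ g hcover hfib').trans ?_
  have hpow : ε ^ (2 * Fintype.card V) * (ε ^ 2)⁻¹ ^ overlap φ ψ = ε ^ #(symmDiff A B) := by
    rw [← hcardN, pow_add, pow_mul, mul_assoc, ← mul_pow, mul_inv_cancel₀ (by positivity), one_pow,
      mul_one]
  rw [mul_assoc, hpow]
  gcongr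
  exact one_le_pow₀ (by norm_num)

/-- The overlap bound for a graph in which neighbours can be chosen so evenly that even two
overlapping copies do not choose a vertex more than `D` times. -/
theorem SBM.overlapBound_of_fibres {M : SBM 2} {D : ℕ} {ε : ℝ} (hM : M.ScaleBound D ε)
    (hD : 2 ≤ D) (hε : 0 < ε) (n : ℕ) {η : ℝ} (hη : 0 ≤ η) (nb : V → V)
    (hnb : ∀ w, H.Adj w (nb w)) {b : ℕ} (hb : 2 * b ≤ D) (hfib : ∀ i, #{w | nb w = i} ≤ b) :
    M.OverlapBound H n ε ((2 ^ (2 * D + 4)) ^ (2 * #H.edgeFinset)) η := by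
  intro φ ψ _
  refine (SBM.abs_fourier_symmDiff_le H hM hD hε φ ψ nb nb hnb hnb fun i => ?_).trans ?_
  · have h1 : ∀ (θ : V ↪ Fin n) (A : Finset (Fin n)), #{w | θ (nb w) = i ∧ θ w ∉ A} ≤ b := by
      intro θ A
      by_cases hi : ∃ a, θ a = i
      · obtain ⟨a, rfl⟩ := hi
        refine le_trans (Finset.card_le_card fun w hw => ?_) (hfib a)
        simp only [Finset.mem_filter, Finset.mem_univ, true_and] at hw ⊢
        exact θ.injective hw.1
      · rw [Finset.card_eq_zero.2 (Finset.filter_eq_empty_iff.2 fun w _ h => hi ⟨_, h.1⟩)]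
        exact Nat.zero_le _
    have := h1 φ (univ.map ψ)
    have := h1 ψ (univ.map φ)
    omega
  · gcongr
    exact le_add_of_nonneg_right (by positivity)

end variance
end

section
open Finset

/-! ### Stars -/

namespace SBM

variable (M : SBM 2)

/-- The `k`-th moment of the mean degree of a random vertex. -/
def degMoment (k : ℕ) : ℝ := ∑ a, M.p a * M.meanDeg a ^ k

/-- The Fourier coefficient of a star is a moment of the mean degree of its centre. -/
theorem fourier_star {V : Type*} [Fintype V] [DecidableEq V] (c : V) (L : Finset V) (hc : c ∉ L) :
    M.fourier (L.image fun l => s(c, l)) = M.degMoment #L := by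
  have hinj : Set.InjOn (fun l => s(c, l)) (L : Set V) := by
    intro l _ l' hl' h
    simp only [Sym2.eq_iff] at h
    rcases h with h | h
    · exact h.2
    · exact absurd (h.1 ▸ hl') hc
  -- Split according to the label `a` of the centre.
  have h1 : ∀ x : V → Fin 2, (∏ i, M.p (x i)) * ∏ e ∈ L.image (fun l => s(c, l)), M.pairQ x e =
      ∑ a, ∏ i, (M.p (x i) * ((if i = c then (if x i = a then 1 else 0) else 1) *
        (if i ∈ L then M.Q a (x i) else 1))) := by
    intro x
    rw [Finset.prod_image hinj]
    simp only [pairQ_mk, Finset.prod_mul_distrib]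
    rw [← Finset.mul_sum]
    congr 1
    rw [Finset.sum_eq_single (x c)]
    · rw [Finset.prod_ite_mem, Finset.univ_inter, Finset.prod_ite_eq' univ c]
      simp
    · intro a _ ha
      rw [Finset.prod_ite_eq' univ c]
      simp [Ne.symm ha]
    · simp
  simp only [fourier, h1]
  rw [Finset.sum_comm]
  refine Finset.sum_congr rfl fun a _ => ?_
  rw [← Fintype.prod_sum (fun i b => M.p b * ((if i = c then (if b = a then 1 else 0) else 1) *
    (if i ∈ L then M.Q a b else 1)))]
  have h2 : ∀ i, ∑ b, M.p b * ((if i = c then (if b = a then 1 else 0) else 1) *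
      (if i ∈ L then M.Q a b else 1)) =
      (if i = c then M.p a else 1) * (if i ∈ L then M.meanDeg a else 1) := by
    intro i
    by_cases hic : i = c
    · subst hic
      simp [hc]
    · by_cases hiL : i ∈ L
      · simp [hic, hiL, meanDeg]
      · simp [hic, hiL, M.p_sum]
  simp_rw [h2]
  rw [Finset.prod_mul_distrib, Finset.prod_ite_eq' univ c, Finset.prod_ite_mem, Finset.univ_inter,
    Finset.prod_const]
  simp

theorem degMoment_nonneg {k : ℕ} (hk : Even k) : 0 ≤ M.degMoment k :=
  Finset.sum_nonneg fun a _ => mul_nonneg (M.p_nonneg a) (hk.pow_nonneg _)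

theorem abs_degMoment_le_one (k : ℕ) : |M.degMoment k| ≤ 1 := by
  calc |M.degMoment k| ≤ ∑ a, |M.p a * M.meanDeg a ^ k| := Finset.abs_sum_le_sum_abs _ _
    _ ≤ ∑ a, M.p a := Finset.sum_le_sum fun a _ => by
        rw [abs_mul, abs_of_nonneg (M.p_nonneg a), abs_pow]
        exact mul_le_of_le_one_right (M.p_nonneg a)
          (pow_le_one₀ (abs_nonneg _) (M.abs_meanDeg_le a))
    _ = 1 := M.p_sum

theorem degMoment_one : M.degMoment 1 = M.edgeMean := by
  simp [degMoment, edgeMean]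

theorem degMoment_two : M.degMoment 2 = M.edgeMean ^ 2 + M.labelVar * M.slope ^ 2 := by
  have h := M.p_one_eq
  simp [degMoment, Fin.sum_univ_two, M.meanDeg_eq, centred, labelVar, h]
  ring

/-- A high moment of the mean degree, from a lower one and the maximal mean degree. -/
theorem degMoment_le {D j : ℕ} (hD : Even D) (hj : Even j) {m : ℝ}
    (hm : ∀ a, |M.meanDeg a| ≤ m) : M.degMoment (D + j) ≤ M.degMoment D * m ^ j := by
  rw [degMoment, degMoment, Finset.sum_mul]
  refine Finset.sum_le_sum fun a _ => ?_
  rw [pow_add, ← mul_assoc]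
  refine mul_le_mul_of_nonneg_left ?_ (mul_nonneg (M.p_nonneg a) (hD.pow_nonneg _))
  rw [← hj.pow_abs]
  exact pow_le_pow_left₀ (abs_nonneg _) (hm a) j

/-- The slope is controlled by every even moment of the mean degree. -/
theorem labelVar_mul_slope_pow_le {D : ℕ} (hD : Even D) :
    M.labelVar * |M.slope| ^ D ≤ 2 ^ D * M.degMoment D := by
  have h0 := M.p_nonneg 0
  have h1 := M.p_nonneg 1
  have hd0 : 0 ≤ |M.meanDeg 0| ^ D := by positivity
  have hd1 : 0 ≤ |M.meanDeg 1| ^ D := by positivity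
  have hs : |M.slope| ^ D ≤ 2 ^ D * (|M.meanDeg 0| ^ D + |M.meanDeg 1| ^ D) := by
    calc |M.slope| ^ D ≤ (|M.meanDeg 0| + |M.meanDeg 1|) ^ D := by
          gcongr
          exact abs_sub _ _
      _ ≤ 2 ^ (D - 1) * (|M.meanDeg 0| ^ D + |M.meanDeg 1| ^ D) :=
          add_pow_le (abs_nonneg _) (abs_nonneg _) D
      _ ≤ _ := by
          gcongr
          · norm_num
          · omega
  have hm : M.degMoment D = M.p 0 * |M.meanDeg 0| ^ D + M.p 1 * |M.meanDeg 1| ^ D := by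
    simp only [degMoment, Fin.sum_univ_two, hD.pow_abs]
  rw [hm]
  calc M.labelVar * |M.slope| ^ D
      ≤ M.labelVar * (2 ^ D * (|M.meanDeg 0| ^ D + |M.meanDeg 1| ^ D)) :=
        mul_le_mul_of_nonneg_left hs M.labelVar_nonneg
    _ = 2 ^ D * (M.p 0 * M.p 1 * |M.meanDeg 0| ^ D + M.p 1 * M.p 0 * |M.meanDeg 1| ^ D) := by
        rw [labelVar]; ring
    _ ≤ _ := by
        gcongr
        · exact mul_le_of_le_one_right h0 (M.p_le_one 1)
        · exact mul_le_of_le_one_right h1 (M.p_le_one 0)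

/-- If the star with `D` edges attains the scale, then the moments of order between `D` and `2 D`
are as small as required by the variance of its signed count. The maximal mean degree `m` satisfies
`p m ^ D ≤ E d ^ D` with `p` the smaller label probability; the two terms of `η` correspond to
`n m² ≥ 1` and `n m² < 1`. -/
theorem degMoment_le_of_star {h s : ℕ} (hs : s ≤ h) {ε : ℝ} (hε : 0 < ε) (hε1 : ε ≤ 1)
    (hstar : M.degMoment (2 * h) = ε ^ (2 * h + 1)) {n : ℕ} (hn : 1 ≤ n) (hnε : 1 ≤ n * ε ^ 2)
    {p : ℝ} (hp : 0 < p) (hp0 : ∀ a, p ≤ M.p a) :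
    M.degMoment (2 * h + 2 * (h - s)) ≤ (ε ^ (2 * h + 1)) ^ 2 *
      (((n * p)⁻¹ + (n * ε ^ 2)⁻¹) * n ^ (s + 1)) := by
  have hn0 : (0 : ℝ) < n := by exact_mod_cast hn
  obtain ⟨a₀, ha₀⟩ : ∃ a₀, ∀ a, |M.meanDeg a| ≤ |M.meanDeg a₀| := by
    obtain ⟨a, -, ha⟩ := Finset.exists_max_image univ (fun a => |M.meanDeg a|) univ_nonempty
    exact ⟨a, fun b => ha b (Finset.mem_univ b)⟩
  set m := |M.meanDeg a₀| with hm
  have hm0 : 0 ≤ m := abs_nonneg _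
  have hD : Even (2 * h) := even_two_mul h
  have hpm : p * m ^ (2 * h) ≤ ε ^ (2 * h + 1) := by
    rw [← hstar, degMoment]
    calc p * m ^ (2 * h) ≤ M.p a₀ * M.meanDeg a₀ ^ (2 * h) := by
          rw [hm, hD.pow_abs]
          exact mul_le_mul_of_nonneg_right (hp0 a₀) (hD.pow_nonneg _)
      _ ≤ _ := Finset.single_le_sum (f := fun a => M.p a * M.meanDeg a ^ (2 * h))
          (fun a _ => mul_nonneg (M.p_nonneg a) (hD.pow_nonneg _)) (Finset.mem_univ a₀)
  refine (M.degMoment_le hD (even_two_mul (h - s)) ha₀).trans ?_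
  rw [hstar, sq, mul_assoc]
  refine mul_le_mul_of_nonneg_left ?_ (by positivity)
  obtain ⟨l, rfl⟩ : ∃ l, h = s + l := ⟨h - s, by omega⟩
  rw [show s + l - s = l by omega]
  rcases le_or_gt 1 (n * m ^ 2) with hbig | hsmall
  · calc m ^ (2 * l) = 1 * m ^ (2 * l) := (one_mul _).symm
      _ ≤ (n * m ^ 2) ^ s * m ^ (2 * l) := by
          gcongr
          exact one_le_pow₀ hbig
      _ = (p * m ^ (2 * (s + l))) * ((n * p)⁻¹ * n ^ (s + 1)) := by
          field_simp
          ring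
      _ ≤ ε ^ (2 * (s + l) + 1) * ((n * p)⁻¹ * n ^ (s + 1)) := by gcongr
      _ ≤ _ := by
          gcongr
          exact le_add_of_nonneg_right (by positivity)
  · have h1 : m ^ (2 * l) ≤ (n : ℝ)⁻¹ ^ l := by
      rw [pow_mul]
      gcongr
      rw [← one_div, le_div_iff₀ hn0, mul_comm]
      exact hsmall.le
    calc m ^ (2 * l) ≤ 1 * 1 * (n : ℝ)⁻¹ ^ l := by rw [one_mul, one_mul]; exact h1
      _ ≤ (n * ε ^ 2) ^ (s + l) * ε⁻¹ * (n : ℝ)⁻¹ ^ l := by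
          gcongr
          · exact one_le_pow₀ hnε
          · exact (one_le_inv₀ hε).2 hε1
      _ = ε ^ (2 * (s + l) + 1) * ((n * ε ^ 2)⁻¹ * n ^ (s + 1)) := by
          have h2 : (n : ℝ)⁻¹ ^ l * n ^ l = 1 := by
            rw [← mul_pow, inv_mul_cancel₀ hn0.ne', one_pow]
          calc (n * ε ^ 2) ^ (s + l) * ε⁻¹ * (n : ℝ)⁻¹ ^ l
              = (n : ℝ) ^ s * ε ^ (2 * (s + l)) * ε⁻¹ * ((n : ℝ)⁻¹ ^ l * n ^ l) := by ring
            _ = (n : ℝ) ^ s * ε ^ (2 * (s + l)) * ε⁻¹ := by rw [h2, mul_one]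
            _ = _ := by
                field_simp
                ring
      _ ≤ _ := by
          gcongr
          exact le_add_of_nonneg_left (by positivity)

end SBM
end

section
open Finset

section star

variable {t : ℕ}

theorem starWithEdges_adj {a b : Fin (t + 1)} :
    (starWithEdges t).Adj a b ↔ a ≠ b ∧ (a = 0 ∨ b = 0) := SimpleGraph.starGraph_adj

/-- The leaves of an embedded star. -/
def leaves {W : Type*} (φ : Fin (t + 1) ↪ W) : Finset W :=
  univ.map ((Fin.succEmb t).trans φ)

theorem mem_leaves {W : Type*} {φ : Fin (t + 1) ↪ W} {u : W} :
    u ∈ leaves φ ↔ ∃ i : Fin t, φ i.succ = u := by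
  simp [leaves]

theorem card_leaves {W : Type*} (φ : Fin (t + 1) ↪ W) : #(leaves φ) = t := by
  simp [leaves]

theorem centre_notMem_leaves {W : Type*} (φ : Fin (t + 1) ↪ W) : φ 0 ∉ leaves φ := by
  rw [mem_leaves]
  rintro ⟨i, hi⟩
  exact Fin.succ_ne_zero i (φ.injective hi)

theorem univ_map_eq_insert_leaves {W : Type*} [DecidableEq W] (φ : Fin (t + 1) ↪ W) :
    univ.map φ = insert (φ 0) (leaves φ) := by
  ext u
  rw [Finset.mem_insert, mem_leaves]
  simp only [Finset.mem_map, Finset.mem_univ, true_and]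
  rw [Fin.exists_fin_succ, eq_comm]

theorem copyEdges_star [DecidableRel (starWithEdges t).Adj] {W : Type*}
    [DecidableEq W] (φ : Fin (t + 1) ↪ W) :
    copyEdges (starWithEdges t) φ = (leaves φ).image fun l => s(φ 0, l) := by
  ext e
  rw [Finset.mem_image]
  constructor
  · intro he
    obtain ⟨e', he', rfl⟩ := Finset.mem_map.1 he
    induction e' using Sym2.ind with
    | _ a b =>
      rw [SimpleGraph.mem_edgeFinset, SimpleGraph.mem_edgeSet, starWithEdges_adj] at he'
      obtain ⟨hne, rfl | rfl⟩ := he'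
      · obtain ⟨i, rfl⟩ := Fin.exists_succ_eq.2 hne.symm
        exact ⟨φ i.succ, mem_leaves.2 ⟨i, rfl⟩, rfl⟩
      · obtain ⟨i, rfl⟩ := Fin.exists_succ_eq.2 hne
        exact ⟨φ i.succ, mem_leaves.2 ⟨i, rfl⟩, Sym2.eq_swap⟩
  · rintro ⟨l, hl, rfl⟩
    obtain ⟨i, rfl⟩ := mem_leaves.1 hl
    exact (mem_copyEdges _).2 (starWithEdges_adj.2 ⟨(Fin.succ_ne_zero i).symm, Or.inl rfl⟩)

theorem SBM.fourier_starWithEdges [DecidableRel (starWithEdges t).Adj] (M : SBM 2) :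
    M.fourier (starWithEdges t).edgeFinset = M.degMoment t := by
  rw [← fourier_copyEdges (starWithEdges t) M (Function.Embedding.refl (Fin (t + 1))),
    copyEdges_star, M.fourier_star _ _ (centre_notMem_leaves _), card_leaves]

/-- Two stars with a common centre differ by a star. -/
theorem symmDiff_copyEdges_star [DecidableRel (starWithEdges t).Adj] {W : Type*}
    [DecidableEq W] {φ ψ : Fin (t + 1) ↪ W}
    (h : φ 0 = ψ 0) : symmDiff (copyEdges (starWithEdges t) φ) (copyEdges (starWithEdges t) ψ) =
      (symmDiff (leaves φ) (leaves ψ)).image fun l => s(φ 0, l) := by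
  rw [copyEdges_star, copyEdges_star, ← h]
  have hinj : Function.Injective fun l => s(φ 0, l) := by
    intro l l' h
    simp only [Sym2.eq_iff] at h
    rcases h with h | h
    · exact h.2
    · exact h.2.trans h.1
  rw [Finset.image_symmDiff _ _ hinj]

theorem overlap_star_of_centre_eq {W : Type*} [DecidableEq W] {φ ψ : Fin (t + 1) ↪ W}
    (h : φ 0 = ψ 0) : overlap φ ψ = #(leaves φ ∩ leaves ψ) + 1 := by
  rw [overlap, univ_map_eq_insert_leaves, univ_map_eq_insert_leaves, ← h,
    ← Finset.insert_inter_distrib, Finset.card_insert_of_notMem]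
  intro hmem
  exact centre_notMem_leaves φ (Finset.mem_inter.1 hmem).1

/-- Two leaves always suffice to find one different from a given vertex. -/
theorem exists_leaf_ne {W : Type*} (φ : Fin (t + 1) ↪ W) (ht : 2 ≤ t) (c : W) :
    ∃ i : Fin (t + 1), i ≠ 0 ∧ φ i ≠ c := by
  by_cases h : φ ⟨1, by omega⟩ = c
  · refine ⟨⟨2, by omega⟩, fun h0 => by simpa using congrArg Fin.val h0, fun h2 => ?_⟩
    simpa using congrArg Fin.val (φ.injective (h.trans h2.symm))
  · exact ⟨⟨1, by omega⟩, fun h0 => by simpa using congrArg Fin.val h0, h⟩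

/-- The neighbours chosen in a star: leaves choose the centre, the centre chooses the leaf `i`. -/
theorem card_star_fibre_le {W : Type*} [DecidableEq W] (φ : Fin (t + 1) ↪ W) {i : Fin (t + 1)}
    (hi : i ≠ 0) (u : W) :
    #{w : Fin (t + 1) | φ (if w = 0 then i else 0) = u} ≤ if u = φ 0 then t else 1 := by
  split_ifs with hu
  · calc _ ≤ #(univ.erase (0 : Fin (t + 1))) := by
          refine Finset.card_le_card fun w hw => ?_
          simp only [Finset.mem_filter, Finset.mem_univ, true_and] at hw
          simp only [Finset.mem_erase, Finset.mem_univ, and_true]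
          rintro rfl
          rw [if_pos rfl, hu] at hw
          exact hi (φ.injective hw)
      _ = t := by simp
  · calc _ ≤ #({0} : Finset (Fin (t + 1))) := by
          refine Finset.card_le_card fun w hw => ?_
          simp only [Finset.mem_filter, Finset.mem_univ, true_and] at hw
          rw [Finset.mem_singleton]
          by_contra h0
          rw [if_neg h0] at hw
          exact hu hw.symm
      _ ≤ 1 := by simp

theorem star_adj_choice {i : Fin (t + 1)} (hi : i ≠ 0) (w : Fin (t + 1)) :
    (starWithEdges t).Adj w (if w = 0 then i else 0) := by
  rw [starWithEdges_adj]
  split_ifs with h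
  · exact ⟨h ▸ hi.symm, Or.inl h⟩
  · exact ⟨h, Or.inr rfl⟩

/-- A short star is controlled by the general overlap bound. -/
theorem SBM.overlapBound_short_star [DecidableRel (starWithEdges t).Adj] {M : SBM 2} {D : ℕ}
    {ε : ℝ} (hM : M.ScaleBound D ε)
    (hD : 2 ≤ D) (hε : 0 < ε) (n : ℕ) {η : ℝ} (hη : 0 ≤ η) (ht1 : 1 ≤ t) (ht : 2 * t ≤ D) :
    M.OverlapBound (starWithEdges t) n ε
      ((2 ^ (2 * D + 4)) ^ (2 * #(starWithEdges t).edgeFinset)) η := by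
  obtain ⟨i, hi⟩ : ∃ i : Fin (t + 1), i ≠ 0 :=
    ⟨⟨1, by omega⟩, fun h => by simpa using congrArg Fin.val h⟩
  refine SBM.overlapBound_of_fibres _ hM hD hε n hη _ (star_adj_choice hi) ht fun u => ?_
  refine (card_star_fibre_le (Function.Embedding.refl _) hi u).trans ?_
  split_ifs
  · exact le_rfl
  · exact ht1

/-- The overlap bound for the star with `D` edges, when it attains the scale. The general bound
covers all pairs but those with a common centre and few common leaves, which differ by a star with
more than `D` edges. -/
theorem SBM.overlapBound_star {M : SBM 2} {D : ℕ} [DecidableRel (starWithEdges D).Adj] {ε : ℝ}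
    (hM : M.ScaleBound D ε)
    (hD : 2 ≤ D) (hDeven : Even D) (hε : 0 < ε) (hstar : M.degMoment D = ε ^ (D + 1))
    {n : ℕ} (hn : 1 ≤ n) (hnε : 1 ≤ n * ε ^ 2) {p : ℝ} (hp : 0 < p) (hp0 : ∀ a, p ≤ M.p a) :
    M.OverlapBound (starWithEdges D) n ε
      ((2 ^ (2 * D + 4)) ^ (2 * #(starWithEdges D).edgeFinset))
      ((n * p)⁻¹ + (n * ε ^ 2)⁻¹) := by
  intro φ ψ _
  have hn0 : (0 : ℝ) < n := by exact_mod_cast hn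
  have hK : (1 : ℝ) ≤ (2 ^ (2 * D + 4)) ^ (2 * #(starWithEdges D).edgeFinset) :=
    one_le_pow₀ (one_le_pow₀ (by norm_num))
  suffices h : |M.fourier (symmDiff (copyEdges (starWithEdges D) φ)
        (copyEdges (starWithEdges D) ψ))| ≤
      (2 ^ (2 * D + 4)) ^ (2 * #(starWithEdges D).edgeFinset) *
        ε ^ (2 * Fintype.card (Fin (D + 1))) * (ε ^ 2)⁻¹ ^ overlap φ ψ ∨
      |M.fourier (symmDiff (copyEdges (starWithEdges D) φ) (copyEdges (starWithEdges D) ψ))| ≤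
        1 * ε ^ (2 * Fintype.card (Fin (D + 1))) *
          (((n * p)⁻¹ + (n * ε ^ 2)⁻¹) * n ^ overlap φ ψ) by
    rcases h with h | h
    · refine h.trans ?_
      gcongr
      exact le_add_of_nonneg_right (by positivity)
    · refine h.trans ?_
      gcongr
      exact le_add_of_nonneg_left (by positivity)
  by_cases hc : φ 0 = ψ 0
  · have hover := overlap_star_of_centre_eq hc
    have hL := card_leaves φ
    have hL' := card_leaves ψ
    set s := #(leaves φ ∩ leaves ψ) with hs
    have h3 := Finset.card_sdiff_add_card_inter (leaves φ) (leaves ψ)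
    have h4 := Finset.card_sdiff_add_card_inter (leaves ψ) (leaves φ)
    rw [Finset.inter_comm (leaves ψ) (leaves φ)] at h4
    by_cases hsD : D ≤ 2 * s
    · left
      obtain ⟨i, hi, -⟩ := exists_leaf_ne φ hD (φ 0)
      refine SBM.abs_fourier_symmDiff_le _ hM hD hε φ ψ (fun w => if w = 0 then i else 0)
        (fun w => if w = 0 then i else 0) (star_adj_choice hi) (star_adj_choice hi) fun u => ?_
      -- The common centre is not counted, and both stars have `D - s` private leaves.
      have hcount : ∀ θ θ' : Fin (D + 1) ↪ Fin n, θ 0 = θ' 0 →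
          #{w : Fin (D + 1) | θ (if w = 0 then i else 0) = u ∧ θ w ∉ univ.map θ'} ≤
            #(leaves θ \ leaves θ') := by
        intro θ θ' h0
        rw [← Finset.card_map θ]
        refine Finset.card_le_card fun v hv => ?_
        obtain ⟨w, hw, rfl⟩ := Finset.mem_map.1 hv
        have hw2 := (Finset.mem_filter.1 hw).2.2
        rw [univ_map_eq_insert_leaves, Finset.mem_insert, not_or] at hw2
        have hw0 : w ≠ 0 := fun h => hw2.1 (h ▸ h0)
        obtain ⟨j, rfl⟩ := Fin.exists_succ_eq.2 hw0
        exact Finset.mem_sdiff.2 ⟨mem_leaves.2 ⟨j, rfl⟩, hw2.2⟩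
      have := hcount φ ψ hc
      have := hcount ψ φ hc.symm
      omega
    · right
      obtain ⟨h, rfl⟩ := hDeven
      have hcard : #(symmDiff (leaves φ) (leaves ψ)) = 2 * h + 2 * (h - s) := by
        rw [symmDiff_def, Finset.sup_eq_union,
          Finset.card_union_of_disjoint disjoint_sdiff_sdiff]
        omega
      have hcent : φ 0 ∉ symmDiff (leaves φ) (leaves ψ) := by
        rw [Finset.mem_symmDiff]
        rintro (h | h)
        · exact centre_notMem_leaves φ h.1
        · exact centre_notMem_leaves ψ (hc ▸ h.1)
      have heven : Even (2 * h + 2 * (h - s)) := by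
        rw [← mul_add]; exact even_two_mul _
      rw [symmDiff_copyEdges_star hc, M.fourier_star _ _ hcent, hcard,
        abs_of_nonneg (M.degMoment_nonneg heven), hover, Fintype.card_fin]
      rw [← two_mul] at hstar
      refine (M.degMoment_le_of_star (by omega) hε hM.le_one hstar hn hnε hp hp0).trans
        (le_of_eq ?_)
      ring
  · left
    obtain ⟨i, hi, hiψ⟩ := exists_leaf_ne φ hD (ψ 0)
    obtain ⟨j, hj, hjφ⟩ := exists_leaf_ne ψ hD (φ 0)
    refine SBM.abs_fourier_symmDiff_le _ hM hD hε φ ψ (fun w => if w = 0 then i else 0)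
      (fun w => if w = 0 then j else 0) (star_adj_choice hi) (star_adj_choice hj) fun u => ?_
    have hempty : ∀ (θ θ' : Fin (D + 1) ↪ Fin n) (k : Fin (D + 1)), θ 0 ≠ θ' 0 → θ k ≠ θ' 0 →
        #{w : Fin (D + 1) | θ (if w = 0 then k else 0) = θ' 0} = 0 := by
      intro θ θ' k h0 hk
      rw [Finset.card_eq_zero]
      refine Finset.filter_eq_empty_iff.2 fun w _ => ?_
      split_ifs
      · exact hk
      · exact h0
    have hle : #{w : Fin (D + 1) | φ (if w = 0 then i else 0) = u ∧ φ w ∉ univ.map ψ} +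
        #{w : Fin (D + 1) | ψ (if w = 0 then j else 0) = u ∧ ψ w ∉ univ.map φ} ≤
        #{w : Fin (D + 1) | φ (if w = 0 then i else 0) = u} +
          #{w : Fin (D + 1) | ψ (if w = 0 then j else 0) = u} := by
      refine Nat.add_le_add ?_ ?_ <;>
        exact Finset.card_le_card fun w hw => Finset.mem_filter.2
          ⟨Finset.mem_univ _, (Finset.mem_filter.1 hw).2.1⟩
    refine hle.trans ?_
    have h1 := card_star_fibre_le φ hi u
    have h2 := card_star_fibre_le ψ hj u
    by_cases huφ : u = φ 0
    · subst huφ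
      rw [hempty ψ φ j (Ne.symm hc) hjφ]
      rw [if_pos rfl] at h1
      omega
    · by_cases huψ : u = ψ 0
      · subst huψ
        rw [hempty φ ψ i hc hiψ]
        rw [if_pos rfl] at h2
        omega
      · rw [if_neg huφ] at h1
        rw [if_neg huψ] at h2
        omega

end star
end

section
open Finset

/-! ### The 4-cycle -/

theorem sum_fin_succ_fun {m k : ℕ} (F : (Fin (m + 1) → Fin k) → ℝ) :
    ∑ y, F y = ∑ a, ∑ z : Fin m → Fin k, F (Fin.cons a z) := by
  rw [← Fintype.sum_prod_type' (fun a (z : Fin m → Fin k) => F (Fin.cons a z)),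
    ← (Fin.consEquiv fun _ => Fin k).sum_comp]
  rfl

/-- The Fourier coefficient of the 4-cycle is the trace of the fourth power of the operator with
matrix `!![a, b; b, c]`, where `a` is the edge mean, `b² = p₀ p₁ β²` for the slope `β` and
`c = p₀ p₁ γ` for the curvature `γ`. -/
theorem SBM.fourier_cycleGraph_four (M : SBM 2)
    [DecidableRel (SimpleGraph.cycleGraph 4).Adj] :
    M.fourier (SimpleGraph.cycleGraph 4).edgeFinset =
      (M.edgeMean ^ 2 + M.labelVar * M.slope ^ 2) ^ 2 +
      2 * (M.labelVar * M.slope ^ 2) * (M.edgeMean + M.labelVar * M.curvature) ^ 2 +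
      (M.labelVar * M.slope ^ 2 + (M.labelVar * M.curvature) ^ 2) ^ 2 := by
  have hE : (SimpleGraph.cycleGraph 4).edgeFinset =
      ({s(0, 1), s(1, 2), s(2, 3), s(3, 0)} : Finset (Sym2 (Fin 4))) := by
    ext e
    induction e using Sym2.ind with
    | _ i j =>
      rw [SimpleGraph.mem_edgeFinset, SimpleGraph.mem_edgeSet, SimpleGraph.cycleGraph_adj]
      revert i j
      decide
  have hprod : ∀ y : Fin 4 → Fin 2,
      ∏ e ∈ ({s(0, 1), s(1, 2), s(2, 3), s(3, 0)} : Finset (Sym2 (Fin 4))), M.pairQ y e =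
        M.Q (y 0) (y 1) * (M.Q (y 1) (y 2) * (M.Q (y 2) (y 3) * M.Q (y 3) (y 0))) := by
    intro y
    rw [Finset.prod_insert (by decide), Finset.prod_insert (by decide),
      Finset.prod_insert (by decide), Finset.prod_singleton]
    rfl
  rw [hE]
  simp only [SBM.fourier, hprod]
  have h1 := M.p_one_eq
  have h2 := M.Q_one_zero
  have htrace : ∑ y : Fin 4 → Fin 2, (∏ i, M.p (y i)) *
      (M.Q (y 0) (y 1) * (M.Q (y 1) (y 2) * (M.Q (y 2) (y 3) * M.Q (y 3) (y 0)))) =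
      ∑ a, ∑ b, ∑ c, ∑ d, M.p a * M.p b * M.p c * M.p d *
        (M.Q a b * (M.Q b c * (M.Q c d * M.Q d a))) := by
    rw [sum_fin_succ_fun]
    refine Finset.sum_congr rfl fun a _ => ?_
    rw [sum_fin_succ_fun]
    refine Finset.sum_congr rfl fun b _ => ?_
    rw [sum_fin_succ_fun]
    refine Finset.sum_congr rfl fun c _ => ?_
    rw [sum_fin_succ_fun]
    refine Finset.sum_congr rfl fun d _ => ?_
    rw [Fintype.sum_unique, Fin.prod_univ_four]
    rfl
  rw [htrace]
  simp only [Fin.sum_univ_two, edgeMean, slope, curvature, meanDeg, labelVar, h1, h2]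
  ring

theorem SBM.overlapBound_cycleGraph_four {M : SBM 2} {D : ℕ} {ε : ℝ}
    [DecidableRel (SimpleGraph.cycleGraph 4).Adj] (hM : M.ScaleBound D ε)
    (hD : 2 ≤ D) (hε : 0 < ε) (n : ℕ) {η : ℝ} (hη : 0 ≤ η) :
    M.OverlapBound (SimpleGraph.cycleGraph 4) n ε
      ((2 ^ (2 * D + 4)) ^ (2 * #(SimpleGraph.cycleGraph 4).edgeFinset)) η := by
  refine SBM.overlapBound_of_fibres _ hM hD hε n hη (fun w => w + 1) (fun w => ?_)
    (b := 1) (by omega) (by decide)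
  rw [SimpleGraph.cycleGraph_adj]
  exact Or.inr (add_sub_cancel_left w 1)

/-! ### The scale of a model and the choice of the statistic -/

theorem exists_pow_eq_of_mem_Icc {x : ℝ} (hx : 0 ≤ x) (hx1 : x ≤ 1) {k : ℕ} (hk : k ≠ 0) :
    ∃ y : ℝ, 0 ≤ y ∧ y ≤ 1 ∧ y ^ k = x :=
  ⟨x ^ (k : ℝ)⁻¹, Real.rpow_nonneg hx _, Real.rpow_le_one hx hx1 (by positivity),
    Real.rpow_inv_natCast_pow hx hk⟩

/-- The scale of a model is attained by the 4-cycle or by a star with `1`, `2` or `D` edges. -/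
theorem SBM.exists_scale (M : SBM 2) {D : ℕ} (hDeven : Even D)
    [DecidableRel (SimpleGraph.cycleGraph 4).Adj] :
    ∃ ε, M.ScaleBound D ε ∧ (M.fourier (SimpleGraph.cycleGraph 4).edgeFinset = ε ^ 4 ∨
      |M.degMoment 1| = ε ^ (1 + 1) ∨ |M.degMoment 2| = ε ^ (2 + 1) ∨
      |M.degMoment D| = ε ^ (D + 1)) := by
  have hC : M.labelVar ^ 4 * M.curvature ^ 4 ≤
      M.fourier (SimpleGraph.cycleGraph 4).edgeFinset := by
    rw [M.fourier_cycleGraph_four]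
    have hπ := M.labelVar_nonneg
    have h1 : 0 ≤ M.labelVar * M.slope ^ 2 := by positivity
    have h2 : ((M.labelVar * M.curvature) ^ 2) ^ 2 ≤
        (M.labelVar * M.slope ^ 2 + (M.labelVar * M.curvature) ^ 2) ^ 2 := by
      gcongr
      exact le_add_of_nonneg_left h1
    have h3 : 0 ≤ (M.edgeMean ^ 2 + M.labelVar * M.slope ^ 2) ^ 2 := sq_nonneg _
    have h4 : 0 ≤ 2 * (M.labelVar * M.slope ^ 2) *
      (M.edgeMean + M.labelVar * M.curvature) ^ 2 := by positivity
    calc M.labelVar ^ 4 * M.curvature ^ 4 = ((M.labelVar * M.curvature) ^ 2) ^ 2 := by ring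
      _ ≤ _ := by linarith
  have hC0 : 0 ≤ M.fourier (SimpleGraph.cycleGraph 4).edgeFinset :=
    le_trans (mul_nonneg (pow_nonneg M.labelVar_nonneg 4) (by positivity)) hC
  obtain ⟨y₁, h10, h11, h1⟩ := exists_pow_eq_of_mem_Icc hC0
    ((le_abs_self _).trans (M.abs_fourier_le_one _)) (k := 4) (by norm_num)
  obtain ⟨y₂, h20, h21, h2⟩ := exists_pow_eq_of_mem_Icc (abs_nonneg _) (M.abs_degMoment_le_one 1)
    (k := 1 + 1) (by norm_num)
  obtain ⟨y₃, h30, h31, h3⟩ := exists_pow_eq_of_mem_Icc (abs_nonneg _) (M.abs_degMoment_le_one 2)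
    (k := 2 + 1) (by norm_num)
  obtain ⟨y₄, h40, h41, h4⟩ := exists_pow_eq_of_mem_Icc (abs_nonneg _) (M.abs_degMoment_le_one D)
    (k := D + 1) (by omega)
  obtain ⟨ε, hε0, hε1, hl1, hl2, hl3, hl4, hε⟩ : ∃ ε : ℝ, 0 ≤ ε ∧ ε ≤ 1 ∧ y₁ ≤ ε ∧ y₂ ≤ ε ∧
      y₃ ≤ ε ∧ y₄ ≤ ε ∧ (y₁ = ε ∨ y₂ = ε ∨ y₃ = ε ∨ y₄ = ε) := by
    refine ⟨max (max y₁ y₂) (max y₃ y₄), ?_, ?_, ?_, ?_, ?_, ?_, ?_⟩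
    · exact h10.trans ((le_max_left _ _).trans (le_max_left _ _))
    · exact max_le (max_le h11 h21) (max_le h31 h41)
    · exact (le_max_left _ _).trans (le_max_left _ _)
    · exact (le_max_right _ _).trans (le_max_left _ _)
    · exact (le_max_left _ _).trans (le_max_right _ _)
    · exact (le_max_right _ _).trans (le_max_right _ _)
    · rcases max_choice (max y₁ y₂) (max y₃ y₄) with h | h <;> rw [h]
      · rcases max_choice y₁ y₂ with h | h <;> simp [h]
      · rcases max_choice y₃ y₄ with h | h <;> simp [h]
  refine ⟨ε, ⟨hε0, hε1, ?_, ?_, ?_, ?_⟩, ?_⟩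
  · rw [← M.degMoment_one, ← h2]
    exact pow_le_pow_left₀ h20 hl2 2
  · have h5 : M.labelVar * M.slope ^ 2 ≤ |M.degMoment 2| := by
      rw [M.degMoment_two]
      refine le_trans ?_ (le_abs_self _)
      exact le_add_of_nonneg_left (sq_nonneg _)
    exact h5.trans (h3 ▸ pow_le_pow_left₀ h30 hl3 3)
  · refine (M.labelVar_mul_slope_pow_le hDeven).trans ?_
    gcongr
    exact (le_abs_self _).trans (h4 ▸ pow_le_pow_left₀ h40 hl4 (D + 1))
  · refine le_of_pow_le_pow_left₀ (n := 4) (by norm_num) hε0 ?_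
    calc (M.labelVar * |M.curvature|) ^ 4 = M.labelVar ^ 4 * M.curvature ^ 4 := by
          rw [mul_pow, (by decide : Even 4).pow_abs]
      _ ≤ y₁ ^ 4 := h1 ▸ hC
      _ ≤ ε ^ 4 := pow_le_pow_left₀ h10 hl1 4
  · rcases hε with rfl | rfl | rfl | rfl
    · exact Or.inl h1.symm
    · exact Or.inr (Or.inl h2.symm)
    · exact Or.inr (Or.inr (Or.inl h3.symm))
    · exact Or.inr (Or.inr (Or.inr h4.symm))

theorem graphVar_const_mul {n : ℕ} (μ f : SimpleGraph (Fin n) → ℝ) (c : ℝ) :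
    graphVar μ (fun G => c * f G) = c ^ 2 * graphVar μ f := by
  have h : ∀ G, (c * f G - c * graphMean μ f) ^ 2 = c ^ 2 * (f G - graphMean μ f) ^ 2 := by
    intro G; ring
  rw [graphVar, graphMean_const_mul]
  simp only [h]
  rw [graphMean_const_mul, graphVar]

/-- The ratio of variance to squared mean of a signed count attaining the scale, as a function of
`u = 1 / (n ε²)` and `η`, up to constants. -/
def varianceRatio (v : ℕ) (u η : ℝ) : ℝ := (1 + v * u) ^ v - 1 + η * (1 + v) ^ v

theorem SBM.OverlapBound.lt_abs_mean_sub {V : Type} [Fintype V] [DecidableEq V] [Nonempty V]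
    {H : SimpleGraph V} [DecidableRel H.Adj] (hH : ∀ a, ∃ b, H.Adj a b) {M : SBM 2} {n : ℕ}
    {ε K η : ℝ} (h : M.OverlapBound H n ε K η) (hK : 1 ≤ K) (hε : 0 < ε) (hη : 0 ≤ η)
    (hΦ : |M.fourier H.edgeFinset| = ε ^ Fintype.card V) (hn : 2 * Fintype.card V ≤ n) {C : ℝ}
    (hC : C ^ 2 * (K * varianceRatio (Fintype.card V) (n * ε ^ 2)⁻¹ η) <
      (1 / 4) ^ Fintype.card V) :
    C * √(max (graphVar (M.law n) (signedCount H))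
        (graphVar (erdosRenyiLaw (1 / 2) n) (signedCount H))) <
      |graphMean (M.law n) (signedCount H) -
        graphMean (erdosRenyiLaw (1 / 2) n) (signedCount H)| := by
  obtain ⟨A, hA, hAeq⟩ := exists_embCount_eq H n
  have hv0 : 0 < Fintype.card V := Fintype.card_pos
  set v := Fintype.card V with hv
  have hn0 : (0 : ℝ) < n := by exact_mod_cast (by omega : 0 < n)
  have hfun : (embCount H : SimpleGraph (Fin n) → ℝ) = fun G => A * signedCount H G := funext hAeq
  have hmeanER : graphMean (erdosRenyiLaw (1 / 2) n) (embCount H) = 0 := by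
    rw [graphMean_embCount]
    refine Finset.sum_eq_zero fun φ _ => ?_
    rw [graphMean_erdosRenyi_signChar (copyEdges_subset H φ), if_neg]
    obtain ⟨a⟩ := ‹Nonempty V›
    obtain ⟨b, hb⟩ := hH a
    exact Finset.ne_empty_of_mem ((mem_copyEdges H).2 hb)
  have hmean : ((n : ℝ) / 2) ^ v * ε ^ v ≤ |graphMean (M.law n) (embCount H)| := by
    have h1 : graphMean (M.law n) (embCount H) =
        Fintype.card (V ↪ Fin n) * M.fourier H.edgeFinset := by
      rw [graphMean_embCount, ← Finset.card_univ, ← nsmul_eq_mul, ← Finset.sum_const]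
      refine Finset.sum_congr rfl fun φ _ => ?_
      rw [graphMean_law_signChar M (copyEdges_subset H φ), fourier_copyEdges]
    rw [h1, abs_mul, hΦ, Nat.abs_cast, Fintype.card_embedding_eq, Fintype.card_fin]
    gcongr
    calc ((n : ℝ) / 2) ^ v ≤ ((n + 1 - v : ℕ) : ℝ) ^ v := by
          gcongr
          rw [Nat.cast_sub (by omega)]
          have : (2 * v : ℝ) ≤ n := by exact_mod_cast hn
          push_cast
          linarith
      _ ≤ _ := by exact_mod_cast Nat.pow_sub_le_descFactorial n v
  set X := max (graphVar (M.law n) (embCount H)) (graphVar (erdosRenyiLaw (1 / 2) n) (embCount H))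
    with hX
  have hvar : X ≤ K * ε ^ (2 * v) * ((n : ℝ) ^ v *
      ((n : ℝ) ^ v * varianceRatio v (n * ε ^ 2)⁻¹ η)) := by
    have h1 : ((n + v * (ε ^ 2)⁻¹) ^ v - (n : ℝ) ^ v) + η * (n + v * n) ^ v =
        (n : ℝ) ^ v * varianceRatio v (n * ε ^ 2)⁻¹ η := by
      have e1 : (n + v * (ε ^ 2)⁻¹ : ℝ) = n * (1 + v * (n * ε ^ 2)⁻¹) := by field_simp
      have e2 : (n + v * n : ℝ) = n * (1 + v) := by ring
      rw [e1, e2, mul_pow, mul_pow, varianceRatio]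
      ring
    rw [← h1]
    exact max_le (h.graphVar_law_le H (zero_le_one.trans hK) hε.le hη)
      (graphVar_erdosRenyi_embCount_le H hH hK hε hη)
  have hkey : C ^ 2 * X < graphMean (M.law n) (embCount H) ^ 2 := by
    have hpos : 0 < ε ^ (2 * v) * (n : ℝ) ^ (2 * v) := by positivity
    calc C ^ 2 * X ≤ C ^ 2 * (K * ε ^ (2 * v) * ((n : ℝ) ^ v *
          ((n : ℝ) ^ v * varianceRatio v (n * ε ^ 2)⁻¹ η))) := by gcongr
      _ = (C ^ 2 * (K * varianceRatio v (n * ε ^ 2)⁻¹ η)) * (ε ^ (2 * v) * (n : ℝ) ^ (2 * v)) := by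
        ring
      _ < (1 / 4) ^ v * (ε ^ (2 * v) * (n : ℝ) ^ (2 * v)) := by gcongr
      _ = (((n : ℝ) / 2) ^ v * ε ^ v) ^ 2 := by
        have : (1 / 4 : ℝ) ^ v = ((1 / 2) ^ v) ^ 2 := by
          rw [← pow_mul, mul_comm, pow_mul]
          norm_num
        rw [this]
        ring
      _ ≤ |graphMean (M.law n) (embCount H)| ^ 2 := by gcongr
      _ = _ := sq_abs _
  have hemb : C * √X < |graphMean (M.law n) (embCount H) -
      graphMean (erdosRenyiLaw (1 / 2) n) (embCount H)| := by
    rw [hmeanER, sub_zero, ← Real.sqrt_sq_eq_abs]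
    have hX0 : 0 ≤ X := le_max_of_le_right
      (Finset.sum_nonneg fun G _ => mul_nonneg (erdosRenyiLaw_half_nonneg n G) (sq_nonneg _))
    calc C * √X ≤ |C| * √X := by gcongr; exact le_abs_self C
      _ = √(C ^ 2 * X) := by rw [Real.sqrt_mul (sq_nonneg C), Real.sqrt_sq_eq_abs]
      _ < _ := Real.sqrt_lt_sqrt (by positivity) hkey
  rw [hX, hfun, graphVar_const_mul, graphVar_const_mul, graphMean_const_mul, graphMean_const_mul,
    ← mul_max_of_nonneg _ _ (sq_nonneg A), Real.sqrt_mul (sq_nonneg A), Real.sqrt_sq hA.le,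
    ← mul_sub, abs_mul, abs_of_pos hA, mul_left_comm] at hemb
  exact lt_of_mul_lt_mul_left hemb hA.le

theorem eventually_varianceRatio_lt (v : ℕ) (K C : ℝ) {u η : ℕ → ℝ}
    (hu : Filter.Tendsto u Filter.atTop (nhds 0)) (hη : Filter.Tendsto η Filter.atTop (nhds 0)) :
    ∀ᶠ n in Filter.atTop, C ^ 2 * (K * varianceRatio v (u n) (η n)) < (1 / 4) ^ v := by
  have h : Filter.Tendsto (fun n => C ^ 2 * (K * varianceRatio v (u n) (η n))) Filter.atTop
      (nhds (C ^ 2 * (K * ((1 + v * 0) ^ v - 1 + 0 * (1 + v) ^ v)))) :=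
    ((((((hu.const_mul (v : ℝ)).const_add 1).pow v).sub_const 1).add
      (hη.mul_const _)).const_mul K).const_mul (C ^ 2)
  refine h.eventually_lt_const ?_
  simp

end

theorem mainTheorem2 (D : ℕ) (hD : 4 ≤ D) (hDeven : Even D) (M : ℕ → SBM 2)
    (hp : Filter.Tendsto (fun n : ℕ => (n : ℝ) * min ((M n).p 0) ((M n).p 1))
      Filter.atTop Filter.atTop)
    (htest : ∃ f : (n : ℕ) → SimpleGraph (Fin n) → ℝ,
      (∀ n, IsPolynomialTest D (f n)) ∧
      Distinguishes (fun n => (M n).law n) (fun n => erdosRenyiLaw (1 / 2) n) f) :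
    ∃ g : (n : ℕ) → SimpleGraph (Fin n) → ℝ,
      (∀ n, g n = signedCount (SimpleGraph.cycleGraph 4) ∨
        ∃ t, 1 ≤ t ∧ t ≤ D ∧ g n = signedCount (starWithEdges t)) ∧
      Distinguishes (fun n => (M n).law n) (fun n => erdosRenyiLaw (1 / 2) n) g := by
  classical
  obtain ⟨f, hf, hdist⟩ := htest
  have hD2 : 2 ≤ D := by omega
  choose ε hM hε using fun n => (M n).exists_scale hDeven
  have hscale := tendsto_scale_of_distinguishes hD2 hM hf hdist
  set p : ℕ → ℝ := fun n => min ((M n).p 0) ((M n).p 1) with hpdef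
  set u : ℕ → ℝ := fun n => (n * ε n ^ 2)⁻¹ with hu
  set η : ℕ → ℝ := fun n => (n * p n)⁻¹ + (n * ε n ^ 2)⁻¹ with hηdef
  have hu0 : Filter.Tendsto u Filter.atTop (nhds 0) := hscale.inv_tendsto_atTop
  have hη0 : Filter.Tendsto η Filter.atTop (nhds 0) := by
    have h := hp.inv_tendsto_atTop.add hu0
    rw [add_zero] at h
    exact h
  let K : ℕ → ℝ := fun m => (2 ^ (2 * D + 4)) ^ (2 * m)
  have hK : ∀ m, 1 ≤ K m := fun m => one_le_pow₀ (one_le_pow₀ (by norm_num))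
  -- The numerical condition under which a graph on `v` vertices with `m` edges that attains the
  -- scale separates the models with constant `C`.
  let P : ℝ → ℕ → ℕ → ℕ → Prop := fun C n v m =>
    C ^ 2 * (K m * varianceRatio v (u n) (η n)) < (1 / 4) ^ v
  let big : ℕ → Prop := fun n => 2 * (D + 1) ≤ n ∧ 1 ≤ n * ε n ^ 2 ∧ 1 ≤ n * p n
  have hstarH : ∀ t, 1 ≤ t → ∀ a, ∃ b, (starWithEdges t).Adj a b := by
    intro t ht a
    have h10 : (⟨1, by omega⟩ : Fin (t + 1)) ≠ 0 := fun h => by simpa using congrArg Fin.val h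
    exact ⟨_, star_adj_choice h10 a⟩
  have hcycH : ∀ a, ∃ b, (SimpleGraph.cycleGraph 4).Adj a b := by
    intro a
    refine ⟨a + 1, ?_⟩
    rw [SimpleGraph.cycleGraph_adj]
    exact Or.inr (add_sub_cancel_left a 1)
  let Good : (n : ℕ) → (SimpleGraph (Fin n) → ℝ) → Prop := fun n g => ∀ C, big n →
    P C n 4 (SimpleGraph.cycleGraph 4).edgeFinset.card →
    (∀ t ∈ ({1, 2, D} : Finset ℕ), P C n (t + 1) (starWithEdges t).edgeFinset.card) →
    C * √(max (graphVar ((M n).law n) g) (graphVar (erdosRenyiLaw (1 / 2) n) g)) <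
      |graphMean ((M n).law n) g - graphMean (erdosRenyiLaw (1 / 2) n) g|
  have hpos : ∀ n, big n → 0 < ε n ∧ 0 ≤ η n ∧ 0 < p n := by
    rintro n ⟨h1, h2, h3⟩
    have hn : (0 : ℝ) < n := by exact_mod_cast (by omega : 0 < n)
    have hp0 : 0 < p n := pos_of_mul_pos_right (lt_of_lt_of_le one_pos h3) hn.le
    refine ⟨lt_of_le_of_ne (hM n).nonneg fun h0 => ?_, ?_, hp0⟩
    · rw [← h0] at h2
      norm_num at h2
    · simp only [hηdef]
      positivity
  have hstar : ∀ n, ∀ t ∈ ({1, 2, D} : Finset ℕ), |(M n).degMoment t| = ε n ^ (t + 1) →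
      (big n → (M n).OverlapBound (starWithEdges t) n (ε n)
        (K (starWithEdges t).edgeFinset.card) (η n)) → Good n (signedCount (starWithEdges t)) := by
    intro n t ht hmom hover C hbig _ hP
    have ht1 : 1 ≤ t ∧ t ≤ D := by
      simp only [Finset.mem_insert, Finset.mem_singleton] at ht
      omega
    obtain ⟨hε0, hη1, -⟩ := hpos n hbig
    refine (hover hbig).lt_abs_mean_sub (hstarH t ht1.1) (hK _) hε0 hη1 ?_ ?_ ?_
    · rw [(M n).fourier_starWithEdges, Fintype.card_fin]
      exact hmom
    · have := hbig.1
      rw [Fintype.card_fin]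
      omega
    · rw [Fintype.card_fin]
      exact hP t ht
  have hsel : ∀ n, ∃ g : SimpleGraph (Fin n) → ℝ, (g = signedCount (SimpleGraph.cycleGraph 4) ∨
        ∃ t, 1 ≤ t ∧ t ≤ D ∧ g = signedCount (starWithEdges t)) ∧ Good n g := by
    intro n
    rcases hε n with h | h | h | h
    · refine ⟨signedCount (SimpleGraph.cycleGraph 4), Or.inl rfl, fun C hbig hP _ => ?_⟩
      obtain ⟨hε0, hη1, -⟩ := hpos n hbig
      refine (SBM.overlapBound_cycleGraph_four (hM n) hD2 hε0 n hη1).lt_abs_mean_sub hcycH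
        (hK _) hε0 hη1 ?_ ?_ ?_
      · rw [h, Fintype.card_fin, abs_of_nonneg (pow_nonneg (hM n).nonneg 4)]
      · have := hbig.1
        rw [Fintype.card_fin]
        omega
      · rw [Fintype.card_fin]
        exact hP
    · refine ⟨_, Or.inr ⟨1, le_rfl, by omega, rfl⟩, hstar n 1 (by simp) h fun hbig => ?_⟩
      exact SBM.overlapBound_short_star (hM n) hD2 (hpos n hbig).1 n (hpos n hbig).2.1 le_rfl
        (by omega)
    · refine ⟨_, Or.inr ⟨2, by omega, by omega, rfl⟩, hstar n 2 (by simp) h fun hbig => ?_⟩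
      exact SBM.overlapBound_short_star (hM n) hD2 (hpos n hbig).1 n (hpos n hbig).2.1 (by omega)
        (by omega)
    · refine ⟨_, Or.inr ⟨D, by omega, le_rfl, rfl⟩, hstar n D (by simp) h fun hbig => ?_⟩
      rw [abs_of_nonneg ((M n).degMoment_nonneg hDeven)] at h
      refine SBM.overlapBound_star (hM n) hD2 hDeven (hpos n hbig).1 h
        (by have := hbig.1; omega) hbig.2.1 (hpos n hbig).2.2 fun a => ?_
      fin_cases a
      · exact min_le_left _ _
      · exact min_le_right _ _
  choose g hg hgC using hsel
  refine ⟨g, hg, fun C => ?_⟩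
  have hbig : ∀ᶠ n in Filter.atTop, big n :=
    (Filter.eventually_ge_atTop _).and
      ((hscale.eventually_ge_atTop 1).and (hp.eventually_ge_atTop 1))
  have hstars : ∀ᶠ n in Filter.atTop, ∀ t ∈ ({1, 2, D} : Finset ℕ),
      P C n (t + 1) (starWithEdges t).edgeFinset.card :=
    (Filter.eventually_all_finset _).2 fun t _ => eventually_varianceRatio_lt _ _ C hu0 hη0
  filter_upwards [hbig, hstars, eventually_varianceRatio_lt 4
    (K (SimpleGraph.cycleGraph 4).edgeFinset.card) C hu0 hη0] with n h1 h2 h3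
  exact hgC n C h1 h3 h2
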